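/- **Setting.** Consider $x_{k+1}=Ax_k+Bw_k$, $y_k=Cx_k+v_k$ ($k\in\mathbb N_0$) with $A\in\mathbb R^{n\times n}$ nonsingular, $B\in\mathbb R^{n\times p}$, $C\in\mathbb R^{m\times n}$. Here $x_0,w_k,v_k$ are uncertain variables, i.e. functions on a sample space, such that for every $k$ the variables $w_0,\dots,w_k,v_0,\dots,v_k,x_0$ are unrelated (their joint range is the product of their ranges). Write $[\![\cdot]\!]$ for ranges. $[\![x_0]\!]$ is non-empty and bounded, and the Euclidean diameters of $[\![w_k]\!]$ and of $[\![v_k]\!]$ are bounded uniformly in $k$. Let $y_0,y_1,\dots$ be observed measurements, i.e. each $y_{0:k}=(y_0,\dots,y_k)$ is realized at some sample point, and let $[\![x_k|y_{0:k}]\!]$ be the set of values of $x_k$ at the sample points at which the first $k+1$ measurements equal $y_{0:k}$. A constrained zonotope is a set $\{\hat G\xi+\hat c:\hat A\xi=\hat b,\ |\xi_j|\le\hat h_j\ \forall j\}$ with $\hat h_j\in[0,\infty]$. All $[\![w_k]\!]$, $[\![v_k]\!]$ and the initial condition $\hat X_0\subset\mathbb R^n$ (a guess for $[\![x_0]\!]$,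 otherwise arbitrary) are constrained zonotopes; $\hat X_0$ is non-empty and bounded. Let $P$ be a nonsingular matrix giving an observability decomposition: in the coordinates $(x^o,x^{\bar o})=Px\in\mathbb R^{n_o}\times\mathbb R^{n_{\bar o}}$ the system reads $x^o_{k+1}=\tilde A_ox^o_k+\tilde B_ow_k$, $x^{\bar o}_{k+1}=\tilde A_{21}x^o_k+\tilde A_{\bar o}x^{\bar o}_k+\tilde B_{\bar o}w_k$, $y_k=\tilde C_ox^o_k+v_k$, with $(\tilde A_o,\tilde C_o)$ observable with observability index $\mu_o$. For $S\subseteq\mathbb R^n$ let $S^o,S^{\bar o}$ be the projections of $PS$. Let $\mathcal X_k=\{x: y_k-Cx\in[\![v_k]\!]\}$, $f_k(S)=\mathcal X_k\cap(AS+B[\![w_{k-1}]\!])$, and $F_{k,i}(S)=f_k\circ\cdots\circ f_{i+1}(\mathcal X_i\cap S)$ for $k\ge i$; its prior set $F^-_{k,i}(S)$ is $S$ if $k=i$ and $A\,F_{k-1,i}(S)+B[\![w_{k-1}]\!]$ if $k>i$. $\overline{\mathrm{IH}}$ denotes the interval hull, $\mathcal B_a[c]$ the closed cube with centre $c$ and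 half edge length $a$, and $d_\infty$ the diameter in the $\infty$-norm. **OIT-CZ SMF.** Fix an integer $\bar\delta\ge\max\{\mu_o-1,0\}$, $\varepsilon>0$, and $$\Upsilon_\infty=\inf_{\gamma\in(\rho(\tilde A_{\bar o}),1)}\frac{\max_{k\in\mathbb N_0}\gamma^{-k}\|\tilde A_{\bar o}^k\|_\infty}{1-\gamma}.$$ All sets below are computed as constrained zonotopes. * For $k<\bar\delta$: let $\mathcal Z_k^-=\hat X_0$ if $k=0$ and $\mathcal Z_k^-=A\mathcal Y_{k-1}+B[\![w_{k-1}]\!]$ if $k>0$, where, in either of two variants used throughout, $\mathcal Y_{k-1}=\mathcal Z_{k-1}$ or $\mathcal Y_{k-1}=F_{k-1,0}(\hat X_0)$. Put $\mathcal Z_k=\mathcal X_k\cap\mathcal Z_k^-$. If this set is empty, reset: $\mathcal Z_k=F_{k,0}(R)$ and $\mathcal Z_k^-=F^-_{k,0}(R)$ with $R=P^{-1}(\mathcal B_\alpha[0]\times\hat X_0^{\bar o})$, where $\alpha>0$ (it may depend on $k$) is sufficiently large to make $\mathcal Z_k$ non-empty if some $\alpha>0$ does. Let $\hat{\mathcal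 T}_k=\overline{\mathrm{IH}}((\mathcal Z_k^-)^{\bar o})$. * For $k\ge\bar\delta$: $\mathcal Z_k=F_{k,k-\bar\delta}\big(P^{-1}(\mathbb R^{n_o}\times\hat{\mathcal T}_{k-\bar\delta})\big)$. Let $c^{\mathrm{in}}_k$ be the centre and $g_k$ the largest half edge length of $\overline{\mathrm{IH}}(\tilde A_{21}\mathcal Z_k^o+\tilde B_{\bar o}[\![w_k]\!])$, $\ell_k=\max\{g_k,\ell_{k-1}\}$ with $\ell_{\bar\delta-1}=0$, and $\hat c_{k+1}=\tilde A_{\bar o}\hat c_k+c^{\mathrm{in}}_k$ with $\hat c_{\bar\delta}$ the centre of $\overline{\mathrm{IH}}(\mathcal Z_{\bar\delta}^{\bar o})$. Let $\hat{\mathcal T}_k=\mathcal B_{\alpha_k}[\hat c_k]$ with $\alpha_k=\|\tilde A_{\bar o}^{k-\bar\delta}\|_\infty\,d_\infty(\mathcal Z_{\bar\delta}^{\bar o})+\Upsilon_\infty\ell_{k-1}+\varepsilon$. (If $\bar\delta=0$, the set $\hat{\mathcal T}_0$ used for $\mathcal Z_0$ is $\overline{\mathrm{IH}}(\hat X_0^{\bar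 o})$.) **Theorem (Properties of OIT-CZ SMF).** If $(A,C)$ is detectable, then: 1. (Stability) $\mathcal Z_k\neq\emptyset$ for all $k\in\mathbb N_0$, and there is $\bar d>0$ such that the Hausdorff distance (in the Euclidean norm) between $\mathcal Z_k$ and $[\![x_k|y_{0:k}]\!]$ is at most $\bar d$ for all $k\in\mathbb N_0$. 2. (Finite-time inclusion) There is $\underline k\ge 2\bar\delta$ such that $\mathcal Z_k\supseteq[\![x_k|y_{0:k}]\!]$ for all $k\ge\underline k$. 3. (Uniform boundedness) There is $\bar d>0$ such that $\mathcal Z_k$ has Euclidean diameter at most $\bar d$ for all $k\in\mathbb N_0$. -/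

import Mathlib

open scoped ENNReal

noncomputable section

namespace SMF

/-! ### The system: uncertain variables, ranges and conditional ranges -/

/-- A linear system driven by uncertain variables, i.e. by functions on a sample space `Ω`:
`x_{k+1} = A x_k + B w_k`, `y_k = C x_k + v_k`. -/
structure UncertainSystem (Ω : Type*) (n p m : ℕ) where
  A : Matrix (Fin n) (Fin n) ℝ
  B : Matrix (Fin n) (Fin p) ℝ
  C : Matrix (Fin m) (Fin n) ℝ
  x0 : Ω → Fin n → ℝ
  w : ℕ → Ω → Fin p → ℝ
  v : ℕ → Ω → Fin m → ℝ

namespace UncertainSystem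

variable {Ω : Type*} {n p m : ℕ}

/-- The state `x_k`. -/
def state (S : UncertainSystem Ω n p m) : ℕ → Ω → Fin n → ℝ
  | 0 => S.x0
  | k + 1 => fun ω => S.A.mulVec (S.state k ω) + S.B.mulVec (S.w k ω)

/-- The measurement `y_k`. -/
def meas (S : UncertainSystem Ω n p m) (k : ℕ) (ω : Ω) : Fin m → ℝ :=
  S.C.mulVec (S.state k ω) + S.v k ω

/-- For every `k`, the variables `w_0, …, w_k, v_0, …, v_k, x_0` are unrelated:
their joint range is the product of their ranges. -/
def Unrelated (S : UncertainSystem Ω n p m) : Prop :=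
  ∀ (k : ℕ) (a : Fin n → ℝ) (b : ℕ → Fin p → ℝ) (e : ℕ → Fin m → ℝ),
    a ∈ Set.range S.x0 → (∀ i ≤ k, b i ∈ Set.range (S.w i)) →
    (∀ i ≤ k, e i ∈ Set.range (S.v i)) →
    ∃ ω, S.x0 ω = a ∧ ∀ i ≤ k, S.w i ω = b i ∧ S.v i ω = e i

/-- `y` is a sequence of observed measurements: each `y_{0:k}` lies in the range of the
uncertain variable formed by the first `k + 1` measurements. -/
def IsObserved (S : UncertainSystem Ω n p m) (y : ℕ → Fin m → ℝ) : Prop :=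
  ∀ k, ∃ ω, ∀ i ≤ k, S.meas i ω = y i

/-- The true conditional range of `x_k` given `y_{0:k}`. -/
def condRange (S : UncertainSystem Ω n p m) (y : ℕ → Fin m → ℝ) (k : ℕ) :
    Set (Fin n → ℝ) :=
  {x | ∃ ω, (∀ i ≤ k, S.meas i ω = y i) ∧ S.state k ω = x}

end UncertainSystem

/-! ### Observability and detectability -/

section LinearSystems

variable {n m : ℕ}

/-- The matrix with the block rows `C, C A, …, C A ^ (μ - 1)`. -/
def obsMatrix (A : Matrix (Fin n) (Fin n) ℝ) (C : Matrix (Fin m) (Fin n) ℝ) (μ : ℕ) :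
    Matrix (Fin μ × Fin m) (Fin n) ℝ :=
  Matrix.of fun r j => (C * A ^ (r.1 : ℕ)) r.2 j

def IsObservable (A : Matrix (Fin n) (Fin n) ℝ) (C : Matrix (Fin m) (Fin n) ℝ) : Prop :=
  (obsMatrix A C n).rank = n

/-- The observability index of an observable pair: the least `μ` such that
`C, C A, …, C A ^ (μ - 1)` together have rank `n`. -/
def obsIndex (A : Matrix (Fin n) (Fin n) ℝ) (C : Matrix (Fin m) (Fin n) ℝ) : ℕ :=
  sInf {μ | (obsMatrix A C μ).rank = n}

/-- `(A, C)` is detectable (in discrete time): each mode of `A` that is not strictly inside the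
unit circle is observable. -/
def IsDetectable (A : Matrix (Fin n) (Fin n) ℝ) (C : Matrix (Fin m) (Fin n) ℝ) : Prop :=
  ∀ (lam : ℂ) (u : Fin n → ℂ), 1 ≤ ‖lam‖ →
    (A.map Complex.ofReal).mulVec u = lam • u → (C.map Complex.ofReal).mulVec u = 0 → u = 0

/-- An observability decomposition of `(A, B, C)`: a nonsingular `P` (with inverse `Pinv`) such that
in the coordinates `(xo, xb) = P x` the system is
`xo⁺ = Ao xo + Bo w`, `xb⁺ = A21 xo + Ab xb + Bb w`, `y = Co xo + v` with `(Ao, Co)` observable. -/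
structure ObsDecomp {p : ℕ} (A : Matrix (Fin n) (Fin n) ℝ) (B : Matrix (Fin n) (Fin p) ℝ)
    (C : Matrix (Fin m) (Fin n) ℝ) (no nb : ℕ) where
  P : Matrix (Fin no ⊕ Fin nb) (Fin n) ℝ
  Pinv : Matrix (Fin n) (Fin no ⊕ Fin nb) ℝ
  Ao : Matrix (Fin no) (Fin no) ℝ
  A21 : Matrix (Fin nb) (Fin no) ℝ
  Ab : Matrix (Fin nb) (Fin nb) ℝ
  Bo : Matrix (Fin no) (Fin p) ℝ
  Bb : Matrix (Fin nb) (Fin p) ℝ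
  Co : Matrix (Fin m) (Fin no) ℝ
  P_mul_Pinv : P * Pinv = 1
  Pinv_mul_P : Pinv * P = 1
  A_eq : P * A * Pinv = Matrix.fromBlocks Ao 0 A21 Ab
  B_eq : P * B = Matrix.fromRows Bo Bb
  C_eq : C * Pinv = Matrix.fromCols Co 0
  observable : IsObservable Ao Co

/-- The matrix norm induced by the `∞`-norm (the maximal absolute row sum). -/
def matInfNorm {ι κ : Type*} [Fintype ι] [Fintype κ] (M : Matrix ι κ ℝ) : ℝ :=
  letI := Matrix.linftyOpNormedAddCommGroup (m := ι) (n := κ) (α := ℝ)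
  ‖M‖

/-- The spectral radius of a real square matrix. -/
def specRadius (M : Matrix (Fin n) (Fin n) ℝ) : ℝ≥0∞ :=
  spectralRadius ℂ (M.map Complex.ofReal)

/-- `inf_{γ ∈ (ρ(M), 1)} max_k {γ⁻ᵏ ‖M ^ k‖_∞} / (1 - γ)`. -/
def upsilonInf (M : Matrix (Fin n) (Fin n) ℝ) : ℝ :=
  sInf {r | ∃ γ : ℝ, specRadius M < ENNReal.ofReal γ ∧ γ < 1 ∧
    r = (⨆ k : ℕ, (γ ^ k)⁻¹ * matInfNorm (M ^ k)) / (1 - γ)}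

end LinearSystems

/-! ### Extended constrained zonotopes -/

/-- (The data of) an extended constrained zonotope in `ℝ^ι`; the finite types `gen` and `con`
index the generators and the constraints. -/
structure CZ (ι : Type) where
  gen : Type
  con : Type
  [fintypeGen : Fintype gen]
  [fintypeCon : Fintype con]
  G : Matrix ι gen ℝ
  c : ι → ℝ
  A : Matrix con gen ℝ
  b : con → ℝ
  h : gen → ℝ≥0∞

attribute [instance] CZ.fintypeGen CZ.fintypeCon

namespace CZ

variable {ι κ : Type}

/-- The set `{G ξ + c : A ξ = b, ξ ∈ ∏ [-h_j, h_j]}`. -/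
def toSet (Z : CZ ι) : Set (ι → ℝ) :=
  {x | ∃ ξ : Z.gen → ℝ, Z.A.mulVec ξ = Z.b ∧ (∀ j, ENNReal.ofReal |ξ j| ≤ Z.h j) ∧
    x = Z.G.mulVec ξ + Z.c}

/-- The linear image `M Z`. -/
abbrev image [Fintype ι] (M : Matrix κ ι ℝ) (Z : CZ ι) : CZ κ where
  gen := Z.gen
  con := Z.con
  G := M * Z.G
  c := M.mulVec Z.c
  A := Z.A
  b := Z.b
  h := Z.h

/-- The product `Z₁ × Z₂`. -/
abbrev prod (Z₁ : CZ ι) (Z₂ : CZ κ) : CZ (ι ⊕ κ) where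
  gen := Z₁.gen ⊕ Z₂.gen
  con := Z₁.con ⊕ Z₂.con
  G := Matrix.fromBlocks Z₁.G 0 0 Z₂.G
  c := Sum.elim Z₁.c Z₂.c
  A := Matrix.fromBlocks Z₁.A 0 0 Z₂.A
  b := Sum.elim Z₁.b Z₂.b
  h := Sum.elim Z₁.h Z₂.h

/-- The box `Z(I, c, [], [], h)`. -/
abbrev box {d : ℕ} (c : Fin d → ℝ) (h : Fin d → ℝ≥0∞) : CZ (Fin d) where
  gen := Fin d
  con := Fin 0
  G := 1
  c := c
  A := 0
  b := 0
  h := h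

/-- The constrained zonotope `M Z + N W` (the prediction step). -/
abbrev predict {α β : Type} [Fintype α] [Fintype β] (M : Matrix ι α ℝ) (N : Matrix ι β ℝ)
    (Z : CZ α) (W : CZ β) : CZ ι where
  gen := Z.gen ⊕ W.gen
  con := Z.con ⊕ W.con
  G := Matrix.fromCols (M * Z.G) (N * W.G)
  c := M.mulVec Z.c + N.mulVec W.c
  A := Matrix.fromBlocks Z.A 0 0 W.A
  b := Sum.elim Z.b W.b
  h := Sum.elim Z.h W.h

/-- The constrained zonotope `{x ∈ Z : y - C x ∈ V}` (the update step). -/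
abbrev update [Fintype ι] (C : Matrix κ ι ℝ) [Fintype κ] (y : κ → ℝ) (V : CZ κ) (Z : CZ ι) :
    CZ ι where
  gen := Z.gen ⊕ V.gen
  con := (Z.con ⊕ V.con) ⊕ κ
  G := Matrix.fromCols Z.G 0
  c := Z.c
  A := Matrix.fromRows (Matrix.fromBlocks Z.A 0 0 V.A) (Matrix.fromCols (C * Z.G) V.G)
  b := Sum.elim (Sum.elim Z.b V.b) (y - V.c - C.mulVec Z.c)
  h := Sum.elim Z.h V.h

end CZ

section IntervalHull

variable {d : ℕ}

/-- The centre of the interval hull of a (bounded, non-empty) set. -/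
def hullCenter (S : Set (Fin d → ℝ)) : Fin d → ℝ :=
  fun i => (sSup ((fun s => s i) '' S) + sInf ((fun s => s i) '' S)) / 2

/-- The half edge lengths of the interval hull. -/
def hullRadius (S : Set (Fin d → ℝ)) : Fin d → ℝ :=
  fun i => (sSup ((fun s => s i) '' S) - sInf ((fun s => s i) '' S)) / 2

/-- The interval hull `Z(I, center, [], [], radius)`. -/
def intervalHull (S : Set (Fin d → ℝ)) : CZ (Fin d) :=
  CZ.box (hullCenter S) fun i => ENNReal.ofReal (hullRadius S i)

/-- The diameter in the `∞`-norm (the norm of `Fin d → ℝ` is the sup norm). -/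
def diamInf (S : Set (Fin d → ℝ)) : ℝ :=
  sSup {r | ∃ s ∈ S, ∃ t ∈ S, r = ‖s - t‖}

end IntervalHull

/-! ### The OIT-inspired constrained zonotopic filter -/

/-- What the filter is run with: the initial condition `X0hat`, constrained zonotopes `W k`, `V k`
for the noise ranges, the observed measurements `y`, and the design parameters. -/
structure FilterData (n p m : ℕ) where
  X0hat : CZ (Fin n)
  W : ℕ → CZ (Fin p)
  V : ℕ → CZ (Fin m)
  y : ℕ → Fin m → ℝ
  /-- window length -/
  δ : ℕ
  ε : ℝ
  /-- `α k` is the half edge length of the cube used if the estimate is reset at time `k`. -/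
  α : ℕ → ℝ
  /-- Whether, in the first phase, the classical recursion continues from the latest, possibly
  reset, estimate (`true`), or always from the classical estimate started at `X0hat` (`false`). -/
  carry : Bool

section OITCZ

variable {n p m no nb : ℕ} {A : Matrix (Fin n) (Fin n) ℝ} {B : Matrix (Fin n) (Fin p) ℝ}
  {C : Matrix (Fin m) (Fin n) ℝ} (D : ObsDecomp A B C no nb) (F : FilterData n p m)

/-- One prediction with `A`, `B` and the noise range at time `k`. -/
def predictStep (A : Matrix (Fin n) (Fin n) ℝ) (B : Matrix (Fin n) (Fin p) ℝ)
    (F : FilterData n p m) (k : ℕ) (Z : CZ (Fin n)) : CZ (Fin n) :=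
  CZ.predict A B Z (F.W k)

/-- One update with the measurement at time `k`. -/
def updateStep (C : Matrix (Fin m) (Fin n) ℝ) (F : FilterData n p m) (k : ℕ)
    (Z : CZ (Fin n)) : CZ (Fin n) :=
  CZ.update C (F.y k) (F.V k) Z

/-- The image of `Z` under the filtering map `F_{i + j, i}`: update at time `i`, followed by `j`
prediction-update steps. -/
def filterMap (A : Matrix (Fin n) (Fin n) ℝ) (B : Matrix (Fin n) (Fin p) ℝ)
    (C : Matrix (Fin m) (Fin n) ℝ) (F : FilterData n p m) (i : ℕ) (Z : CZ (Fin n)) :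
    ℕ → CZ (Fin n)
  | 0 => updateStep C F i Z
  | j + 1 => updateStep C F (i + j + 1) (predictStep A B F (i + j) (filterMap A B C F i Z j))

/-- Projection of `P Z` to the observable coordinates. -/
def projO (Z : CZ (Fin n)) : CZ (Fin no) := CZ.image D.P.toRows₁ Z

/-- Projection of `P Z` to the unobservable coordinates. -/
def projB (Z : CZ (Fin n)) : CZ (Fin nb) := CZ.image D.P.toRows₂ Z

/-- `P⁻¹ (Zo × Zb)`. -/
def assemble (Zo : CZ (Fin no)) (Zb : CZ (Fin nb)) : CZ (Fin n) :=
  CZ.image D.Pinv (CZ.prod Zo Zb)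

/-- The initial set of a reset: `P⁻¹ (cube of half edge length a at 0 × projection of X0hat)`. -/
def resetInit (a : ℝ) : CZ (Fin n) :=
  assemble D (CZ.box 0 fun _ => ENNReal.ofReal a) (projB D F.X0hat)

/-- The estimate that a reset with half edge length `a` at time `k` produces. -/
def resetEstimate (a : ℝ) (k : ℕ) : CZ (Fin n) :=
  filterMap A B C F 0 (resetInit D F a) k

/-- The prior set that occurs at time `k` in the computation of `resetEstimate`. -/
def resetPrior (a : ℝ) : ℕ → CZ (Fin n)
  | 0 => resetInit D F a
  | k + 1 => predictStep A B F k (resetEstimate D F a k)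

/-- The cubes used for resetting in the first phase are sufficiently large: the estimate
after a reset is non-empty, provided that this can be achieved with some cube. -/
def ResetsLargeEnough : Prop :=
  ∀ k < F.δ, 0 < F.α k ∧
    ((∃ a : ℝ, 0 < a ∧ (resetEstimate D F a k).toSet.Nonempty) →
      (resetEstimate D F (F.α k) k).toSet.Nonempty)

/-! In the following definitions `Zs` stands for the sequence of estimates. -/

/-- The prior set of the classical filter at time `k`. -/
def classicalPrior (A : Matrix (Fin n) (Fin n) ℝ) (B : Matrix (Fin n) (Fin p) ℝ)
    (C : Matrix (Fin m) (Fin n) ℝ) (F : FilterData n p m) (Zs : ℕ → CZ (Fin n)) :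
    ℕ → CZ (Fin n)
  | 0 => F.X0hat
  | k + 1 => predictStep A B F k (if F.carry then Zs k else filterMap A B C F 0 F.X0hat k)

open scoped Classical in
/-- The prior set that is finally used at time `k` in the first phase: that of the classical filter
or, if the latter returns the empty set, that of the reset. -/
def prior (Zs : ℕ → CZ (Fin n)) (k : ℕ) : CZ (Fin n) :=
  if (updateStep C F k (classicalPrior A B C F Zs k)).toSet = ∅ then resetPrior D F (F.α k) k
  else classicalPrior A B C F Zs k

open scoped Classical in
/-- The estimate at time `k` in the first phase. -/
def earlyEstimate (Zs : ℕ → CZ (Fin n)) (k : ℕ) : CZ (Fin n) :=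
  if (updateStep C F k (classicalPrior A B C F Zs k)).toSet = ∅ then
    resetEstimate D F (F.α k) k
  else updateStep C F k (classicalPrior A B C F Zs k)

/-- The set of possible inputs `A21 xo + Bb w` of the unobservable subsystem at time `k`. -/
def inputSet (Zs : ℕ → CZ (Fin n)) (k : ℕ) : Set (Fin nb → ℝ) :=
  (CZ.predict D.A21 D.Bb (projO D (Zs k)) (F.W k)).toSet

/-- `ell Zs j` is `ℓ_{δ + j - 1}`, the largest half edge length of the interval hulls of the input
sets at the times `δ, …, δ + j - 1`. -/
def ell (Zs : ℕ → CZ (Fin n)) : ℕ → ℝ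
  | 0 => 0
  | j + 1 => max (matInfNorm (Matrix.diagonal (hullRadius (inputSet D F Zs (F.δ + j)))))
      (ell Zs j)

/-- `centerB Zs j` is the centre of the cube for the unobservable coordinates at time `δ + j`. -/
def centerB (Zs : ℕ → CZ (Fin n)) : ℕ → Fin nb → ℝ
  | 0 => hullCenter (projB D (Zs F.δ)).toSet
  | j + 1 => D.Ab.mulVec (centerB Zs j) + hullCenter (inputSet D F Zs (F.δ + j))

/-- The half edge length of the cube for the unobservable coordinates at time `δ + j`. -/
def radiusB (Zs : ℕ → CZ (Fin n)) (j : ℕ) : ℝ :=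
  matInfNorm (D.Ab ^ j) * diamInf (projB D (Zs F.δ)).toSet
    + upsilonInf D.Ab * ell D F Zs j + F.ε

/-- The set for the unobservable coordinates at time `k`: the interval hull of the projected prior
for `k < δ`, a cube for `k ≥ δ`. (If `δ = 0`, the first estimate itself needs such a set
at time `0`, before the cubes are available; it is the interval hull, too.) -/
def unobsSet (Zs : ℕ → CZ (Fin n)) (k : ℕ) : CZ (Fin nb) :=
  if k < max F.δ 1 then intervalHull (projB D (prior D F Zs k)).toSet
  else CZ.box (centerB D F Zs (k - F.δ)) fun _ => ENNReal.ofReal (radiusB D F Zs (k - F.δ))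

/-- The estimate at time `k` in terms of the earlier ones. -/
def nextEstimate (Zs : ℕ → CZ (Fin n)) (k : ℕ) : CZ (Fin n) :=
  if k < F.δ then earlyEstimate D F Zs k
  else filterMap A B C F (k - F.δ)
    (assemble D (CZ.box 0 fun _ => ⊤) (unobsSet D F Zs (k - F.δ))) F.δ

/-- The estimates of the OIT-inspired constrained zonotopic filter. (At time `k` only the estimates
at times `i < k` are used; the value in the `else` branch plays no role.) -/
def estimate (k : ℕ) : CZ (Fin n) :=
  nextEstimate D F (fun i => if _h : i < k then estimate i else F.X0hat) k
termination_by k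

/-- `nextEstimate` at time `k` depends on the estimates at times `i < k` only. -/
theorem nextEstimate_congr {Zs Ys : ℕ → CZ (Fin n)} {k : ℕ} (h : ∀ i < k, Zs i = Ys i) :
    nextEstimate D F Zs k = nextEstimate D F Ys k := by
  have hcp : ∀ j ≤ k, classicalPrior A B C F Zs j = classicalPrior A B C F Ys j := by
    rintro (_ | j) hj
    · rfl
    · simp only [classicalPrior, h j (by omega)]
  have hell : ∀ j, F.δ + j ≤ k → ell D F Zs j = ell D F Ys j := by
    intro j; induction j with
    | zero => intro _; rfl
    | succ j ih => intro hj; simp only [ell, inputSet, h (F.δ + j) (by omega), ih (by omega)]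
  have hc : ∀ j, F.δ < k → F.δ + j ≤ k → centerB D F Zs j = centerB D F Ys j := by
    intro j; induction j with
    | zero => intro h1 _; simp only [centerB, h _ h1]
    | succ j ih => intro h1 hj; simp only [centerB, inputSet, h (F.δ + j) (by omega), ih h1 (by omega)]
  unfold nextEstimate
  split_ifs with hk
  · simp only [earlyEstimate, hcp k le_rfl]
  · congr 2
    unfold unobsSet
    split_ifs with h2
    · simp only [prior, hcp (k - F.δ) (by omega)]
    · have hd : F.δ < k := by omega
      simp only [radiusB, hell (k - F.δ - F.δ) (by omega), hc (k - F.δ - F.δ) hd (by omega), h _ hd]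

/-- The estimates satisfy the recursion of the algorithm. -/
theorem estimate_eq (k : ℕ) : estimate D F k = nextEstimate D F (estimate D F) k := by
  rw [estimate]
  exact nextEstimate_congr D F fun i hi => by simp [hi]

end OITCZ

/-! ### Boundedness and stability -/

section Stability

variable {n : ℕ}

/-- A sequence of sets whose Euclidean diameters have a common bound. -/
def UniformlyBounded (S : ℕ → Set (Fin n → ℝ)) : Prop :=
  ∃ d : ℝ, 0 < d ∧ ∀ k, ∀ s ∈ S k, ∀ t ∈ S k, ‖WithLp.toLp 2 (s - t)‖ ≤ d

/-- The estimation gap: the Hausdorff distance in the Euclidean norm. -/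
def gap (Z R : Set (Fin n → ℝ)) : ℝ≥0∞ :=
  Metric.hausdorffEDist ((WithLp.toLp 2 '' Z : Set (EuclideanSpace ℝ (Fin n))))
    (WithLp.toLp 2 '' R)

/-- A filter with the estimates `Z k` for the true conditional ranges `R k` is stable if it is
well-posed and its estimation gap is bounded. -/
def IsStable (Z R : ℕ → Set (Fin n → ℝ)) : Prop :=
  (∀ k, (Z k).Nonempty) ∧ ∃ d : ℝ, 0 < d ∧ ∀ k, gap (Z k) (R k) ≤ ENNReal.ofReal d

end Stability

end SMF

end

/-! Detectability forces `D.Ab` to be Schur stable (`specRadius_Ab_lt_one`), so its powers are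
summable in norm with sum at most `upsilonInf D.Ab`.

Boundedness rests on observability over a window. Two trajectories that explain the same `δ + 1 ≥
μ_o` measurements have nearly equal outputs, so their observable coordinates differ by a constant
that depends only on the system and the noise diameters, never on the set where the window starts
(`exists_filterMap_bound`). This breaks the apparent circularity between cube sizes and estimates:
the input sets of the unobservable subsystem are bounded a priori, hence so are `ell`, the cubes
(`exists_unobsSet_bound`), and finally the estimates.

Inclusion uses that measurements do not see the unobservable coordinates. A window started from all
of `ℝ^no` times a non-empty set always retains a point with the true observable coordinates
(`exists_mem_estimate`), even while the estimate misses the true state. Hence the true input of the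
unobservable subsystem lies in the computed input set, and the error of the cube centre obeys a
stable recursion driven by inputs of norm at most `ell`. Its forced part is at most `upsilonInf D.Ab
* ell`, and its transient eventually drops below `ε`, uniformly in the sample point
(`exists_unobs_mem`). From then on the cube contains the true unobservable coordinates, and the
window started from it contains the conditional range.

Stability follows from the two: after inclusion the Hausdorff distance is at most the diameter of
the estimate, and the finitely many earlier gaps are finite (`isStable_of_eventually_subset`). -/

namespace SMF

/-! ### Constrained zonotope operations as operations on sets. -/

namespace CZ

variable {ι κ : Type}

theorem mem_image [Fintype ι] (M : Matrix κ ι ℝ) (Z : CZ ι) (x : κ → ℝ) :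
    x ∈ (image M Z).toSet ↔ ∃ z ∈ Z.toSet, x = M.mulVec z := by
  constructor
  · rintro ⟨ξ, h1, h2, rfl⟩
    exact ⟨_, ⟨ξ, h1, h2, rfl⟩, by simp [Matrix.mulVec_add]⟩
  · rintro ⟨_, ⟨ξ, h1, h2, rfl⟩, rfl⟩
    exact ⟨ξ, h1, h2, by simp [Matrix.mulVec_add]⟩

theorem mem_prod (Z₁ : CZ ι) (Z₂ : CZ κ) (x : ι ⊕ κ → ℝ) :
    x ∈ (prod Z₁ Z₂).toSet ↔ x ∘ Sum.inl ∈ Z₁.toSet ∧ x ∘ Sum.inr ∈ Z₂.toSet := by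
  constructor
  · rintro ⟨ξ, h1, h2, rfl⟩
    simp only [Matrix.fromBlocks_mulVec, Sum.elim_eq_iff, Matrix.zero_mulVec, add_zero,
      zero_add] at h1
    refine ⟨⟨ξ ∘ Sum.inl, h1.1, fun j => h2 (Sum.inl j), ?_⟩,
      ⟨ξ ∘ Sum.inr, h1.2, fun j => h2 (Sum.inr j), ?_⟩⟩ <;>
    · ext i; simp [Matrix.fromBlocks_mulVec]
  · rintro ⟨⟨ξ, h1, h2, h3⟩, ⟨η, h4, h5, h6⟩⟩
    refine ⟨Sum.elim ξ η, ?_, ?_, ?_⟩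
    · simp [Matrix.fromBlocks_mulVec, h1, h4]
    · rintro (j | j)
      · exact h2 j
      · exact h5 j
    · ext (i | i)
      · simpa [Matrix.fromBlocks_mulVec] using congrFun h3 i
      · simpa [Matrix.fromBlocks_mulVec] using congrFun h6 i

theorem mem_box {d : ℕ} (c : Fin d → ℝ) (h : Fin d → ℝ≥0∞) (x : Fin d → ℝ) :
    x ∈ (box c h).toSet ↔ ∀ i, ENNReal.ofReal |x i - c i| ≤ h i := by
  constructor
  · rintro ⟨ξ, -, h2, rfl⟩ i
    simpa using h2 i
  · intro hx
    exact ⟨x - c, Subsingleton.elim _ _, hx, by simp⟩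

theorem mem_predict {α β : Type} [Fintype α] [Fintype β] (M : Matrix ι α ℝ) (N : Matrix ι β ℝ)
    (Z : CZ α) (W : CZ β) (x : ι → ℝ) :
    x ∈ (predict M N Z W).toSet ↔
      ∃ z ∈ Z.toSet, ∃ w ∈ W.toSet, x = M.mulVec z + N.mulVec w := by
  constructor
  · rintro ⟨ξ, h1, h2, rfl⟩
    simp only [Matrix.fromBlocks_mulVec, Sum.elim_eq_iff, Matrix.zero_mulVec, add_zero,
      zero_add] at h1
    refine ⟨_, ⟨ξ ∘ Sum.inl, h1.1, fun j => h2 (Sum.inl j), rfl⟩,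
      _, ⟨ξ ∘ Sum.inr, h1.2, fun j => h2 (Sum.inr j), rfl⟩, ?_⟩
    simp only [Matrix.fromCols_mulVec, Matrix.mulVec_add, Matrix.mulVec_mulVec]
    abel
  · rintro ⟨_, ⟨ξ, h1, h2, rfl⟩, _, ⟨η, h4, h5, rfl⟩, rfl⟩
    refine ⟨Sum.elim ξ η, ?_, ?_, ?_⟩
    · simp [Matrix.fromBlocks_mulVec, h1, h4]
    · rintro (j | j)
      · exact h2 j
      · exact h5 j
    · simp only [Matrix.fromCols_mulVec, Matrix.mulVec_add, Matrix.mulVec_mulVec,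
        Sum.elim_comp_inl, Sum.elim_comp_inr]
      abel

theorem mem_update [Fintype ι] [Fintype κ] (C : Matrix κ ι ℝ) (y : κ → ℝ) (V : CZ κ) (Z : CZ ι)
    (x : ι → ℝ) :
    x ∈ (update C y V Z).toSet ↔ x ∈ Z.toSet ∧ y - C.mulVec x ∈ V.toSet := by
  constructor
  · rintro ⟨ξ, h1, h2, rfl⟩
    simp only [Matrix.fromRows_mulVec, Matrix.fromCols_mulVec, Matrix.fromBlocks_mulVec,
      Sum.elim_eq_iff, Matrix.zero_mulVec, add_zero, zero_add] at h1
    obtain ⟨⟨h3, h4⟩, h5⟩ := h1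
    refine ⟨⟨ξ ∘ Sum.inl, h3, fun j => h2 (Sum.inl j), ?_⟩,
      ⟨ξ ∘ Sum.inr, h4, fun j => h2 (Sum.inr j), ?_⟩⟩
    · simp [Matrix.fromCols_mulVec]
    · simp only [Matrix.fromCols_mulVec, Matrix.mulVec_add, Matrix.mulVec_mulVec,
        Matrix.zero_mulVec, add_zero]
      rw [← sub_eq_iff_eq_add'.2 h5.symm]
      abel
  · rintro ⟨⟨ξ, h1, h2, rfl⟩, ⟨η, h4, h5, h6⟩⟩
    refine ⟨Sum.elim ξ η, ?_, ?_, ?_⟩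
    · simp only [Matrix.fromRows_mulVec, Matrix.fromCols_mulVec, Matrix.fromBlocks_mulVec,
        Sum.elim_eq_iff, Matrix.zero_mulVec, add_zero, zero_add, Sum.elim_comp_inl,
        Sum.elim_comp_inr]
      refine ⟨⟨h1, h4⟩, ?_⟩
      rw [← sub_eq_iff_eq_add.2 h6, Matrix.mulVec_add, Matrix.mulVec_mulVec]
      abel
    · rintro (j | j)
      · exact h2 j
      · exact h5 j
    · simp [Matrix.fromCols_mulVec]

end CZ

/-! ### Growth of matrix powers in the induced ∞-norm. -/

section Norms

attribute [local instance] Matrix.linftyOpNormedAddCommGroup Matrix.linftyOpNormedRing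
  Matrix.linftyOpNormedAlgebra

theorem matInfNorm_nonneg {ι κ : Type*} [Fintype ι] [Fintype κ] (M : Matrix ι κ ℝ) :
    0 ≤ matInfNorm M := norm_nonneg M

theorem norm_mulVec_le {ι κ : Type*} [Fintype ι] [Fintype κ] (M : Matrix ι κ ℝ) (x : κ → ℝ) :
    ‖M.mulVec x‖ ≤ matInfNorm M * ‖x‖ :=
  Matrix.linfty_opNorm_mulVec M x

theorem matInfNorm_diagonal {d : ℕ} (r : Fin d → ℝ) : matInfNorm (Matrix.diagonal r) = ‖r‖ :=
  Matrix.linfty_opNorm_diagonal r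

theorem matInfNorm_eq_norm_map {d : ℕ} (M : Matrix (Fin d) (Fin d) ℝ) :
    matInfNorm M = ‖M.map Complex.ofReal‖ := by
  change ‖M‖ = _
  simp [Matrix.linfty_opNorm_def]

/-- Powers of a matrix decay at every rate above the spectral radius. -/
theorem bddAbove_matInfNorm_pow {d : ℕ} (M : Matrix (Fin d) (Fin d) ℝ) {γ : ℝ}
    (hγ : specRadius M < ENNReal.ofReal γ) :
    BddAbove (Set.range fun k : ℕ => (γ ^ k)⁻¹ * matInfNorm (M ^ k)) := by
  have hγ0 : 0 < γ := by
    by_contra h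
    rw [ENNReal.ofReal_of_nonpos (not_lt.1 h)] at hγ
    exact not_lt_bot hγ
  have key := spectrum.pow_nnnorm_pow_one_div_tendsto_nhds_spectralRadius (M.map Complex.ofReal)
  have ev := key.eventually (gt_mem_nhds hγ)
  -- By Gelfand's formula the `k`-th root of the norm of the `k`-th power tends to the spectral
  -- radius, which is below `γ`; so the scaled norms are eventually at most `1`.
  refine Filter.IsBoundedUnder.bddAbove_range ⟨1, ?_⟩
  rw [Filter.eventually_map]
  filter_upwards [ev, Filter.eventually_gt_atTop 0] with k hk hk0
  have hpow : (M ^ k).map Complex.ofReal = (M.map Complex.ofReal) ^ k :=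
    Matrix.map_pow M Complex.ofRealHom k
  have hk1 : (0 : ℝ) < k := by exact_mod_cast hk0
  rw [one_div, ENNReal.rpow_inv_lt_iff hk1, ENNReal.rpow_natCast, ← ENNReal.ofReal_pow hγ0.le,
    ← enorm_eq_nnnorm, ← ofReal_norm, ENNReal.ofReal_lt_ofReal_iff (by positivity), ← hpow,
    ← matInfNorm_eq_norm_map] at hk
  rw [inv_mul_le_iff₀ (by positivity), mul_one]
  exact hk.le

/-- Each admissible `γ` gives a geometric majorant `K * γ ^ i`, whose full sum is the corresponding
competitor in the infimum. Stability of `M` makes the set of competitors non-empty, so that the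
infimum is not the default value `0`. -/
theorem sum_matInfNorm_pow_le_upsilonInf {d : ℕ} (M : Matrix (Fin d) (Fin d) ℝ)
    (hM : specRadius M < 1) (j : ℕ) :
    ∑ i ∈ Finset.range j, matInfNorm (M ^ i) ≤ upsilonInf M := by
  refine le_csInf ?_ ?_
  · obtain ⟨γ, h1, h2⟩ := ENNReal.lt_iff_exists_real_btwn.1 hM
    exact ⟨_, γ, h2.1, by simpa using h2.2, rfl⟩
  · rintro r ⟨γ, h1, h2, rfl⟩
    have hγ0 : 0 < γ := by
      by_contra h
      rw [ENNReal.ofReal_of_nonpos (not_lt.1 h)] at h1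
      exact not_lt_bot h1
    have hb := bddAbove_matInfNorm_pow M h1
    set K := ⨆ k : ℕ, (γ ^ k)⁻¹ * matInfNorm (M ^ k) with hK
    have hle : ∀ k, matInfNorm (M ^ k) ≤ K * γ ^ k := fun k => by
      have := le_ciSup hb k
      rw [← hK] at this
      rwa [inv_mul_le_iff₀ (by positivity), mul_comm] at this
    have hK0 : 0 ≤ K := by
      have := (matInfNorm_nonneg _).trans (hle 0)
      simpa using this
    calc ∑ i ∈ Finset.range j, matInfNorm (M ^ i) ≤ ∑ i ∈ Finset.range j, K * γ ^ i :=
          Finset.sum_le_sum fun i _ => hle i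
      _ = K * ∑ i ∈ Finset.range j, γ ^ i := by rw [Finset.mul_sum]
      _ ≤ K * (1 - γ)⁻¹ := by
          rw [← tsum_geometric_of_lt_one hγ0.le h2]
          exact mul_le_mul_of_nonneg_left ((summable_geometric_of_lt_one hγ0.le h2).sum_le_tsum _
            fun i _ => by positivity) hK0
      _ = _ := (div_eq_mul_inv _ _).symm

theorem tendsto_matInfNorm_pow {d : ℕ} (M : Matrix (Fin d) (Fin d) ℝ)
    (hM : specRadius M < 1) :
    Filter.Tendsto (fun k : ℕ => matInfNorm (M ^ k)) Filter.atTop (nhds 0) :=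
  (summable_of_sum_range_le (fun _ => matInfNorm_nonneg _)
    (sum_matInfNorm_pow_le_upsilonInf M hM)).tendsto_atTop_zero

theorem specRadius_lt_one {d : ℕ} (M : Matrix (Fin d) (Fin d) ℝ)
    (h : ∀ (lam : ℂ) (u : Fin d → ℂ), 1 ≤ ‖lam‖ →
      (M.map Complex.ofReal).mulVec u = lam • u → u = 0) : specRadius M < 1 := by
  unfold specRadius
  -- The spectrum is empty only for `d = 0`; otherwise the spectral radius is attained at an
  -- eigenvalue.
  rcases (spectrum ℂ (M.map Complex.ofReal)).eq_empty_or_nonempty with he | hne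
  · simp [spectralRadius, he]
  · obtain ⟨lam, hl, hr⟩ := spectrum.exists_nnnorm_eq_spectralRadius_of_nonempty hne
    rw [← hr]
    by_contra hcon
    have h1 : 1 ≤ ‖lam‖ := by
      rw [not_lt] at hcon
      exact_mod_cast hcon
    rw [← Matrix.spectrum_toLin', ← Module.End.hasEigenvalue_iff_mem_spectrum] at hl
    obtain ⟨u, hu⟩ := hl.exists_hasEigenvector
    refine hu.2 (h lam u h1 ?_)
    simpa using hu.apply_eq_smul

end Norms

/-- An error system with stable dynamics, driven by bounded inputs. -/
theorem norm_le_of_recursion {d : ℕ} (M : Matrix (Fin d) (Fin d) ℝ) {e u : ℕ → Fin d → ℝ} {l : ℝ}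
    (j : ℕ) (he : ∀ i < j, e (i + 1) = M.mulVec (e i) + u i) (hu : ∀ i < j, ‖u i‖ ≤ l) :
    ‖e j - (M ^ j).mulVec (e 0)‖ ≤ (∑ i ∈ Finset.range j, matInfNorm (M ^ i)) * l := by
  -- Variation of constants; the exponents run backwards, hence the reflection of the sum below.
  have hsol : ∀ k ≤ j, e k = (M ^ k).mulVec (e 0) +
      ∑ i ∈ Finset.range k, (M ^ (k - 1 - i)).mulVec (u i) := by
    intro k
    induction k with
    | zero => intro _; simp
    | succ k ih =>
      intro hk
      rw [he k (by omega), ih (by omega), Finset.sum_range_succ, Matrix.mulVec_add,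
        Matrix.mulVec_mulVec, ← pow_succ', Matrix.mulVec_sum, add_assoc]
      congr 2
      · refine Finset.sum_congr rfl fun i hi => ?_
        have := Finset.mem_range.1 hi
        rw [Matrix.mulVec_mulVec, ← pow_succ']
        congr 2; omega
      · simp
  rw [hsol j le_rfl, add_sub_cancel_left, Finset.sum_mul,
    ← Finset.sum_range_reflect (fun i => matInfNorm (M ^ i) * l)]
  refine norm_sum_le_of_le _ fun i hi => (norm_mulVec_le _ _).trans ?_
  exact mul_le_mul_of_nonneg_left (hu i (Finset.mem_range.1 hi)) (matInfNorm_nonneg _)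

/-! ### Centre and radius of interval hulls. -/

section IntervalHull

variable {d : ℕ}

theorem norm_sub_hullCenter_le {T : Set (Fin d → ℝ)} (hT : Bornology.IsBounded T)
    {u : Fin d → ℝ} (hu : u ∈ T) : ‖u - hullCenter T‖ ≤ ‖hullRadius T‖ := by
  refine (pi_norm_le_iff_of_nonneg (norm_nonneg _)).2 fun i => ?_
  have hb : Bornology.IsBounded ((fun s : Fin d → ℝ => s i) '' T) :=
    (LipschitzWith.eval i).isBounded_image hT
  have h1 := le_csSup hb.bddAbove ⟨u, hu, rfl⟩
  have h2 := csInf_le hb.bddBelow ⟨u, hu, rfl⟩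
  refine le_trans ?_ (norm_le_pi_norm (hullRadius T) i)
  refine le_trans ?_ (le_abs_self _)
  simp only [hullCenter, hullRadius, Pi.sub_apply, Real.norm_eq_abs, abs_le] at *
  constructor <;> linarith

theorem norm_hullRadius_le {T : Set (Fin d → ℝ)} {r : ℝ} (hr : 0 ≤ r)
    (hT : ∀ s ∈ T, ∀ t ∈ T, ‖s - t‖ ≤ r) : ‖hullRadius T‖ ≤ r := by
  refine (pi_norm_le_iff_of_nonneg hr).2 fun i => ?_
  -- For the empty set supremum and infimum are both `0` by convention, so the radius vanishes.
  rcases T.eq_empty_or_nonempty with rfl | ⟨t, ht⟩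
  · simpa [hullRadius] using hr
  have h0 : ∀ s ∈ T, ∀ t ∈ T, s i - t i ≤ r := fun s hs t ht =>
    (le_abs_self _).trans ((norm_le_pi_norm (s - t) i).trans (hT s hs t ht))
  have hne : ((fun s : Fin d → ℝ => s i) '' T).Nonempty := ⟨_, t, ht, rfl⟩
  have h1 : sSup ((fun s : Fin d → ℝ => s i) '' T) ≤
      r + sInf ((fun s : Fin d → ℝ => s i) '' T) := by
    refine csSup_le hne ?_
    rintro _ ⟨s, hs, rfl⟩
    rw [← sub_le_iff_le_add']
    refine le_csInf hne ?_
    rintro _ ⟨t, ht, rfl⟩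
    have := h0 s hs t ht
    simp only; linarith
  have h2 : sInf ((fun s : Fin d → ℝ => s i) '' T) ≤ sSup ((fun s : Fin d → ℝ => s i) '' T) := by
    refine Real.sInf_le_sSup _ ?_ ?_
    · refine ⟨t i - r, ?_⟩
      rintro _ ⟨s, hs, rfl⟩
      have := h0 t ht s hs
      simp only; linarith
    · refine ⟨t i + r, ?_⟩
      rintro _ ⟨s, hs, rfl⟩
      have := h0 s hs t ht
      simp only; linarith
  simp only [hullRadius, Real.norm_eq_abs, abs_le]
  constructor <;> linarith

theorem diamInf_nonneg (T : Set (Fin d → ℝ)) : 0 ≤ diamInf T := by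
  refine Real.sSup_nonneg ?_
  rintro _ ⟨s, -, t, -, rfl⟩
  exact norm_nonneg _

end IntervalHull

end SMF

namespace SMF

/-! ### Sup norm versus Euclidean norm, uniform boundedness, and the estimation gap. -/

section Euclidean

theorem norm_le_norm_toLp {n : ℕ} (x : Fin n → ℝ) : ‖x‖ ≤ ‖WithLp.toLp 2 x‖ :=
  (pi_norm_le_iff_of_nonneg (norm_nonneg _)).2 fun i => PiLp.norm_apply_le (WithLp.toLp 2 x) i

theorem exists_norm_toLp_le (n : ℕ) :
    ∃ c : ℝ, 0 < c ∧ ∀ x : Fin n → ℝ, ‖WithLp.toLp 2 x‖ ≤ c * ‖x‖ := by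
  let f : (Fin n → ℝ) →L[ℝ] EuclideanSpace ℝ (Fin n) :=
    (PiLp.continuousLinearEquiv 2 ℝ (fun _ : Fin n => ℝ)).symm
  -- The summand `1` keeps the constant positive when `n = 0`.
  refine ⟨‖f‖ + 1, by positivity, fun x => (f.le_opNorm x).trans ?_⟩
  gcongr
  linarith

theorem UniformlyBounded.exists_norm_sub_le {n : ℕ} {S : ℕ → Set (Fin n → ℝ)}
    (h : UniformlyBounded S) :
    ∃ d : ℝ, 0 ≤ d ∧ ∀ k, ∀ s ∈ S k, ∀ t ∈ S k, ‖s - t‖ ≤ d := by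
  obtain ⟨d, hd, h⟩ := h
  exact ⟨d, hd.le, fun k s hs t ht => (norm_le_norm_toLp _).trans (h k s hs t ht)⟩

theorem isBounded_of_norm_sub_le {E : Type*} [SeminormedAddCommGroup E] {T : Set E} {d : ℝ}
    (h : ∀ s ∈ T, ∀ t ∈ T, ‖s - t‖ ≤ d) : Bornology.IsBounded T :=
  Metric.isBounded_iff.2 ⟨d, fun s hs t ht => by rw [dist_eq_norm]; exact h s hs t ht⟩

theorem exists_forall_lt_le (f : ℕ → ℝ) (N : ℕ) : ∃ K : ℝ, 0 ≤ K ∧ ∀ k < N, f k ≤ K := by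
  refine ⟨∑ k ∈ Finset.range N, |f k|, Finset.sum_nonneg fun _ _ => abs_nonneg _, fun k hk => ?_⟩
  exact (le_abs_self _).trans
    (Finset.single_le_sum (fun i _ => abs_nonneg (f i)) (Finset.mem_range.2 hk))

theorem uniformlyBounded_of_le {n : ℕ} {S : ℕ → Set (Fin n → ℝ)} {d : ℝ} (N : ℕ)
    (h0 : ∀ k < N, Bornology.IsBounded (S k))
    (h : ∀ k, N ≤ k → ∀ s ∈ S k, ∀ t ∈ S k, ‖s - t‖ ≤ d) : UniformlyBounded S := by
  obtain ⟨c, hc, hcx⟩ := exists_norm_toLp_le n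
  obtain ⟨K, hK, hK'⟩ := exists_forall_lt_le (fun k => Metric.diam (S k)) N
  refine ⟨c * (K + |d| + 1), by positivity, fun k s hs t ht => (hcx _).trans ?_⟩
  gcongr
  rcases lt_or_ge k N with hk | hk
  · have := Metric.dist_le_diam_of_mem (h0 k hk) hs ht
    rw [dist_eq_norm] at this
    linarith [hK' k hk, abs_nonneg d]
  · linarith [h k hk s hs t ht, le_abs_self d]

theorem isBounded_toLp_image {n : ℕ} {T : Set (Fin n → ℝ)} (hT : Bornology.IsBounded T) :
    Bornology.IsBounded (WithLp.toLp 2 '' T : Set (EuclideanSpace ℝ (Fin n))) := by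
  obtain ⟨c, hc, hcx⟩ := exists_norm_toLp_le n
  obtain ⟨d, hd⟩ := Metric.isBounded_iff.1 hT
  refine isBounded_of_norm_sub_le (d := c * d) ?_
  rintro _ ⟨s, hs, rfl⟩ _ ⟨t, ht, rfl⟩
  rw [← WithLp.toLp_sub]
  refine (hcx _).trans ?_
  have := hd hs ht
  rw [dist_eq_norm] at this
  gcongr

/-- Uniformly bounded estimates that eventually contain the non-empty bounded sets `R k` are
stable. -/
theorem isStable_of_eventually_subset {n : ℕ} {Z R : ℕ → Set (Fin n → ℝ)} (k₀ : ℕ)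
    (hZ : ∀ k, (Z k).Nonempty) (hZb : UniformlyBounded Z) (hR : ∀ k, (R k).Nonempty)
    (hRb : ∀ k, Bornology.IsBounded (R k)) (hsub : ∀ k, k₀ ≤ k → R k ⊆ Z k) : IsStable Z R := by
  refine ⟨hZ, ?_⟩
  obtain ⟨d, hd, hdZ⟩ := id hZb
  obtain ⟨e, -, he⟩ := hZb.exists_norm_sub_le
  obtain ⟨K, hK, hK'⟩ := exists_forall_lt_le (fun k => (gap (Z k) (R k)).toReal) k₀
  refine ⟨K + d, by positivity, fun k => ?_⟩
  rcases lt_or_ge k k₀ with hk | hk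
  · have hfin : gap (Z k) (R k) ≠ ⊤ :=
      Metric.hausdorffEDist_ne_top_of_nonempty_of_bounded ((hZ k).image _) ((hR k).image _)
        (isBounded_toLp_image (isBounded_of_norm_sub_le (he k))) (isBounded_toLp_image (hRb k))
    rw [← ENNReal.ofReal_toReal hfin]
    exact ENNReal.ofReal_le_ofReal (by linarith [hK' k hk])
  · obtain ⟨r, hr⟩ := hR k
    -- As `R k ⊆ Z k`, any fixed `r ∈ R k` is within the diameter of `Z k` of every point of `Z k`,
    -- and points of `R k` are at distance zero from `Z k`.
    refine Metric.hausdorffEDist_le_of_mem_edist ?_ ?_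
    · rintro _ ⟨s, hs, rfl⟩
      refine ⟨_, ⟨r, hr, rfl⟩, ?_⟩
      rw [edist_dist, dist_eq_norm, ← WithLp.toLp_sub]
      exact ENNReal.ofReal_le_ofReal (by linarith [hdZ k s hs r (hsub k hk hr)])
    · rintro _ ⟨s, hs, rfl⟩
      exact ⟨_, ⟨s, hsub k hk hs, rfl⟩, by simp⟩

theorem isBounded_mulVec_image {n m : ℕ} (M : Matrix (Fin m) (Fin n) ℝ) {T : Set (Fin n → ℝ)}
    (hT : Bornology.IsBounded T) : Bornology.IsBounded (M.mulVec '' T) := by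
  obtain ⟨d, hd⟩ := Metric.isBounded_iff.1 hT
  refine isBounded_of_norm_sub_le (d := matInfNorm M * d) ?_
  rintro _ ⟨s, hs, rfl⟩ _ ⟨t, ht, rfl⟩
  rw [← Matrix.mulVec_sub]
  have := hd hs ht
  rw [dist_eq_norm] at this
  exact (norm_mulVec_le _ _).trans (mul_le_mul_of_nonneg_left this (matInfNorm_nonneg _))

end Euclidean

/-! ### Boundedness of the true state at each fixed time. -/

section System

variable {Ω : Type*} {n p m : ℕ} (S : UncertainSystem Ω n p m)

theorem isBounded_range_state (hx0 : Bornology.IsBounded (Set.range S.x0))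
    (hw : ∀ k, Bornology.IsBounded (Set.range (S.w k))) (k : ℕ) :
    Bornology.IsBounded (Set.range (S.state k)) := by
  induction k with
  | zero => exact hx0
  | succ k ih =>
    refine ((isBounded_mulVec_image S.A ih).add (isBounded_mulVec_image S.B (hw k))).subset ?_
    rintro _ ⟨ω, rfl⟩
    exact Set.add_mem_add ⟨_, ⟨ω, rfl⟩, rfl⟩ ⟨_, ⟨ω, rfl⟩, rfl⟩

end System

/-! ### Observability decomposition and the contraction of a measurement window. -/

section Filter

variable {n p m no nb : ℕ} {A : Matrix (Fin n) (Fin n) ℝ} {B : Matrix (Fin n) (Fin p) ℝ}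
  {C : Matrix (Fin m) (Fin n) ℝ}

namespace ObsDecomp

variable (D : ObsDecomp A B C no nb)

theorem fromRows_mul_A : Matrix.fromRows (D.P.toRows₁ * A) (D.P.toRows₂ * A) =
    Matrix.fromRows (D.Ao * D.P.toRows₁) (D.A21 * D.P.toRows₁ + D.Ab * D.P.toRows₂) := by
  have h : D.P * A = Matrix.fromBlocks D.Ao 0 D.A21 D.Ab * D.P := by
    rw [← D.A_eq, Matrix.mul_assoc, D.Pinv_mul_P, Matrix.mul_one]
  rw [← Matrix.fromRows_mul, Matrix.fromRows_toRows, h]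
  nth_rw 1 [← Matrix.fromRows_toRows D.P]
  rw [Matrix.fromBlocks_mul_fromRows]
  simp

theorem P1_mul_A : D.P.toRows₁ * A = D.Ao * D.P.toRows₁ :=
  (Matrix.fromRows_ext_iff _ _ _ _).1 D.fromRows_mul_A |>.1

theorem P2_mul_A : D.P.toRows₂ * A = D.A21 * D.P.toRows₁ + D.Ab * D.P.toRows₂ :=
  (Matrix.fromRows_ext_iff _ _ _ _).1 D.fromRows_mul_A |>.2

theorem P1_mul_B : D.P.toRows₁ * B = D.Bo := by
  have h := D.B_eq
  rw [← Matrix.fromRows_toRows D.P, Matrix.fromRows_mul] at h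
  exact ((Matrix.fromRows_ext_iff _ _ _ _).1 h).1

theorem P2_mul_B : D.P.toRows₂ * B = D.Bb := by
  have h := D.B_eq
  rw [← Matrix.fromRows_toRows D.P, Matrix.fromRows_mul] at h
  exact ((Matrix.fromRows_ext_iff _ _ _ _).1 h).2

theorem Co_mul_P1 : D.Co * D.P.toRows₁ = C := by
  have h : C = (Matrix.fromCols D.Co 0 : Matrix (Fin m) (Fin no ⊕ Fin nb) ℝ) * D.P := by
    rw [← D.C_eq, Matrix.mul_assoc, D.Pinv_mul_P, Matrix.mul_one]
  rw [← Matrix.fromRows_toRows D.P, Matrix.fromCols_mul_fromRows, Matrix.zero_mul, add_zero] at h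
  exact h.symm

theorem norm_le (x : Fin n → ℝ) :
    ‖x‖ ≤ matInfNorm D.Pinv * (‖D.P.toRows₁.mulVec x‖ + ‖D.P.toRows₂.mulVec x‖) := by
  have h : x = D.Pinv.mulVec (D.P.mulVec x) := by
    rw [Matrix.mulVec_mulVec, D.Pinv_mul_P, Matrix.one_mulVec]
  nth_rw 1 [h]
  refine (norm_mulVec_le _ _).trans (mul_le_mul_of_nonneg_left ?_ (matInfNorm_nonneg _))
  refine (pi_norm_le_iff_of_nonneg (by positivity)).2 ?_
  rintro (i | i)
  · exact (norm_le_pi_norm (D.P.toRows₁.mulVec x) i).trans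
      (by linarith [norm_nonneg (D.P.toRows₂.mulVec x)])
  · exact (norm_le_pi_norm (D.P.toRows₂.mulVec x) i).trans
      (by linarith [norm_nonneg (D.P.toRows₁.mulVec x)])

/-- An eigenvector `u` of `D.Ab` lifts to the eigenvector `Pinv (0, u)` of `A` with the same
eigenvalue, and `C` annihilates it; detectability excludes this outside the open unit disc. -/
theorem specRadius_Ab_lt_one (hdet : IsDetectable A C) : specRadius D.Ab < 1 := by
  refine specRadius_lt_one _ fun lam u hlam hu => ?_
  set f : ℝ →+* ℂ := Complex.ofRealHom
  have hPP : D.P.map f * D.Pinv.map f = 1 := by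
    rw [← Matrix.map_mul, D.P_mul_Pinv]; simp
  have hAP : A.map f * D.Pinv.map f =
      D.Pinv.map f * (Matrix.fromBlocks D.Ao 0 D.A21 D.Ab).map f := by
    rw [← Matrix.map_mul, ← Matrix.map_mul, ← D.A_eq, ← Matrix.mul_assoc, ← Matrix.mul_assoc,
      D.Pinv_mul_P, Matrix.one_mul]
  have hCP : C.map f * D.Pinv.map f = (Matrix.fromCols D.Co 0).map f := by
    rw [← Matrix.map_mul, D.C_eq]
  set v : Fin no ⊕ Fin nb → ℂ := Sum.elim 0 u with hv
  have h0 : (D.Pinv.map f).mulVec v = 0 := by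
    refine hdet lam _ hlam ?_ ?_
    · change (A.map f).mulVec _ = _
      rw [Matrix.mulVec_mulVec, hAP, ← Matrix.mulVec_mulVec, ← Matrix.mulVec_smul]
      congr 1
      rw [Matrix.fromBlocks_map, Matrix.fromBlocks_mulVec]
      ext (i | i)
      · simp [hv]
      · have : (D.Ab.map f).mulVec u i = (lam • u) i := congrFun hu i
        simpa [hv] using this
    · change (C.map f).mulVec _ = _
      rw [Matrix.mulVec_mulVec, hCP]
      have : (Matrix.fromCols D.Co 0).map f =
          Matrix.fromCols (D.Co.map f) (0 : Matrix (Fin m) (Fin nb) ℂ) := by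
        ext i (j | j) <;> simp
      rw [this, Matrix.fromCols_mulVec]
      simp [hv]
  have : v = 0 := by
    rw [← Matrix.one_mulVec v, ← hPP, ← Matrix.mulVec_mulVec, h0, Matrix.mulVec_zero]
  ext i
  simpa [hv] using congrFun this (Sum.inr i)

end ObsDecomp

theorem mem_predictStep (F : FilterData n p m) (k : ℕ) (Z : CZ (Fin n)) (x : Fin n → ℝ) :
    x ∈ (predictStep A B F k Z).toSet ↔
      ∃ z ∈ Z.toSet, ∃ w ∈ (F.W k).toSet, x = A.mulVec z + B.mulVec w :=
  CZ.mem_predict A B Z (F.W k) x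

theorem mem_updateStep (F : FilterData n p m) (k : ℕ) (Z : CZ (Fin n)) (x : Fin n → ℝ) :
    x ∈ (updateStep C F k Z).toSet ↔ x ∈ Z.toSet ∧ F.y k - C.mulVec x ∈ (F.V k).toSet :=
  CZ.mem_update C (F.y k) (F.V k) Z x

theorem mem_assemble (D : ObsDecomp A B C no nb) (Zo : CZ (Fin no)) (Zb : CZ (Fin nb))
    (x : Fin n → ℝ) : x ∈ (assemble D Zo Zb).toSet ↔
      D.P.toRows₁.mulVec x ∈ Zo.toSet ∧ D.P.toRows₂.mulVec x ∈ Zb.toSet := by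
  have h : x ∈ (assemble D Zo Zb).toSet ↔ D.P.mulVec x ∈ (CZ.prod Zo Zb).toSet := by
    unfold assemble
    rw [CZ.mem_image]
    constructor
    · rintro ⟨z, hz, rfl⟩
      rwa [Matrix.mulVec_mulVec, D.P_mul_Pinv, Matrix.one_mulVec]
    · intro hx
      exact ⟨_, hx, by rw [Matrix.mulVec_mulVec, D.Pinv_mul_P, Matrix.one_mulVec]⟩
  rw [h, CZ.mem_prod]
  rfl

theorem exists_coords (D : ObsDecomp A B C no nb) (a : Fin no → ℝ) (b : Fin nb → ℝ) :
    ∃ x, D.P.toRows₁.mulVec x = a ∧ D.P.toRows₂.mulVec x = b := by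
  have h : D.P.mulVec (D.Pinv.mulVec (Sum.elim a b)) = Sum.elim a b := by
    rw [Matrix.mulVec_mulVec, D.P_mul_Pinv, Matrix.one_mulVec]
  exact ⟨D.Pinv.mulVec (Sum.elim a b), funext fun i => congrFun h (Sum.inl i),
    funext fun i => congrFun h (Sum.inr i)⟩

/-- The points of the filtered set are the end points of the trajectories that are compatible with
the measurements. -/
theorem exists_trajectory (F : FilterData n p m) (i : ℕ) (Z : CZ (Fin n)) (j : ℕ) {s : Fin n → ℝ}
    (hs : s ∈ (filterMap A B C F i Z j).toSet) :
    ∃ (x : ℕ → Fin n → ℝ) (w : ℕ → Fin p → ℝ), x 0 ∈ Z.toSet ∧ x j = s ∧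
      (∀ l < j, x (l + 1) = A.mulVec (x l) + B.mulVec (w l) ∧ w l ∈ (F.W (i + l)).toSet) ∧
      ∀ l ≤ j, F.y (i + l) - C.mulVec (x l) ∈ (F.V (i + l)).toSet := by
  induction j generalizing s with
  | zero =>
    obtain ⟨h1, h2⟩ := (mem_updateStep F i Z s).1 hs
    refine ⟨fun _ => s, fun _ => 0, h1, rfl, by simp, ?_⟩
    intro l hl
    obtain rfl : l = 0 := by omega
    exact h2
  | succ j ih =>
    obtain ⟨h1, h2⟩ := (mem_updateStep F _ _ s).1 hs
    obtain ⟨z, hz, b, hb, rfl⟩ := (mem_predictStep F _ _ _).1 h1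
    obtain ⟨x, w, hx0, hxj, hstep, hmeas⟩ := ih hz
    -- The trajectory ending at `z` is prolonged by one step; noise `l` drives the transition from
    -- `l` to `l + 1`, hence `<` for the noise and `≤` for the states.
    refine ⟨fun l => if l ≤ j then x l else A.mulVec z + B.mulVec b,
      fun l => if l < j then w l else b, by simpa using hx0, by simp, ?_, ?_⟩
    · intro l hl
      rcases Nat.lt_or_ge l j with h | h
      · have h' : l + 1 ≤ j := h
        simpa [h, h.le, h'] using hstep l h
      · obtain rfl : l = j := by omega
        simpa [hxj] using hb
    · intro l hl
      rcases Nat.lt_or_ge j l with h | h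
      · obtain rfl : l = j + 1 := by omega
        simpa [← add_assoc] using h2
      · simpa [h] using hmeas l h

/-- Over a window that is long enough for observability, two points of a filtered set differ
by a bounded amount, up to the unobservable part of the set filtered. -/
theorem exists_filterMap_bound (D : ObsDecomp A B C no nb) (F : FilterData n p m) {d : ℝ}
    (hd : 0 ≤ d)
    (hW : ∀ k, ∀ a ∈ (F.W k).toSet, ∀ b ∈ (F.W k).toSet, ‖a - b‖ ≤ d)
    (hV : ∀ k, ∀ a ∈ (F.V k).toSet, ∀ b ∈ (F.V k).toSet, ‖a - b‖ ≤ d)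
    (hδ : obsIndex D.Ao D.Co ≤ F.δ + 1) :
    ∃ K : ℝ, 0 ≤ K ∧ ∀ (i : ℕ) (Z : CZ (Fin n)),
      ∀ s ∈ (filterMap A B C F i Z F.δ).toSet, ∀ t ∈ (filterMap A B C F i Z F.δ).toSet,
        ‖D.P.toRows₁.mulVec (s - t)‖ ≤ K ∧
        ∃ a ∈ Z.toSet, ∃ b ∈ Z.toSet, ‖s - t‖ ≤ K * (1 + ‖D.P.toRows₂.mulVec (a - b)‖) := by
  have hrank : (obsMatrix D.Ao D.Co (obsIndex D.Ao D.Co)).rank = no :=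
    Nat.sInf_mem (s := {μ | (obsMatrix D.Ao D.Co μ).rank = no}) ⟨no, D.observable⟩
  set μ := obsIndex D.Ao D.Co
  -- Full column rank means injectivity, and an injective linear map in finite dimension is bounded
  -- below.
  obtain ⟨L, hL⟩ : ∃ L : NNReal, ∀ e, ‖e‖ ≤ L * ‖(obsMatrix D.Ao D.Co μ).mulVec e‖ := by
    have hinj : Function.Injective (obsMatrix D.Ao D.Co μ).mulVecLin := by
      rw [← LinearMap.ker_eq_bot, ← Submodule.finrank_eq_zero]
      have h1 := (obsMatrix D.Ao D.Co μ).mulVecLin.finrank_range_add_finrank_ker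
      have h2 : Module.finrank ℝ (LinearMap.range (obsMatrix D.Ao D.Co μ).mulVecLin) = no := hrank
      simp at h1
      omega
    obtain ⟨L, -, hL⟩ := LinearMap.exists_antilipschitzWith _ (LinearMap.ker_eq_bot.2 hinj)
    exact ⟨L, fun e => by simpa using hL.le_mul_dist e 0⟩
  set So := ∑ l ∈ Finset.range F.δ, matInfNorm (D.Ao ^ l)
  set Sa := ∑ l ∈ Finset.range F.δ, matInfNorm (A ^ l)
  have hSo : 0 ≤ So := Finset.sum_nonneg fun _ _ => matInfNorm_nonneg _
  have hSa : 0 ≤ Sa := Finset.sum_nonneg fun _ _ => matInfNorm_nonneg _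
  set ro := So * (matInfNorm D.Bo * d)
  set ra := Sa * (matInfNorm B * d)
  have hro : 0 ≤ ro := mul_nonneg hSo (mul_nonneg (matInfNorm_nonneg _) hd)
  have hra : 0 ≤ ra := mul_nonneg hSa (mul_nonneg (matInfNorm_nonneg _) hd)
  set K₁ := L * (d + matInfNorm D.Co * ro)
  have hK₁ : 0 ≤ K₁ :=
    mul_nonneg L.2 (add_nonneg hd (mul_nonneg (matInfNorm_nonneg _) hro))
  set K₂ := matInfNorm (D.Ao ^ F.δ) * K₁ + ro
  have hK₂ : 0 ≤ K₂ :=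
    add_nonneg (mul_nonneg (matInfNorm_nonneg _) hK₁) hro
  set g := matInfNorm (A ^ F.δ) * matInfNorm D.Pinv
  have hg : 0 ≤ g := mul_nonneg (matInfNorm_nonneg _) (matInfNorm_nonneg _)
  -- `K₁` and `K₂` bound the observable difference at the start and at the end of the window, `ra`
  -- the effect of noise on the full state, and `g` transports the initial difference. The sum
  -- serves both claims.
  refine ⟨K₂ + g * K₁ + g + ra, add_nonneg (add_nonneg (add_nonneg hK₂ (mul_nonneg hg hK₁)) hg) hra, fun i Z s hs t ht => ?_⟩
  obtain ⟨x, w, hx0, rfl, hstep, hmeas⟩ := exists_trajectory F i Z F.δ hs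
  obtain ⟨x', w', hx0', rfl, hstep', hmeas'⟩ := exists_trajectory F i Z F.δ ht
  have hdw : ∀ l < F.δ, ‖w l - w' l‖ ≤ d := fun l hl =>
    hW _ _ (hstep l hl).2 _ (hstep' l hl).2
  have he : ∀ l < F.δ, x (l + 1) - x' (l + 1) =
      A.mulVec (x l - x' l) + B.mulVec (w l - w' l) := fun l hl => by
    rw [(hstep l hl).1, (hstep' l hl).1, Matrix.mulVec_sub, Matrix.mulVec_sub]; abel
  have hea := norm_le_of_recursion A (e := fun l => x l - x' l)
    (u := fun l => B.mulVec (w l - w' l)) (l := matInfNorm B * d) F.δ he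
    fun l hl => (norm_mulVec_le _ _).trans
      (mul_le_mul_of_nonneg_left (hdw l hl) (matInfNorm_nonneg _))
  have heo : ∀ l ≤ F.δ, ‖D.P.toRows₁.mulVec (x l - x' l) -
      (D.Ao ^ l).mulVec (D.P.toRows₁.mulVec (x 0 - x' 0))‖ ≤ ro := fun l hl => by
    refine (norm_le_of_recursion D.Ao (e := fun l => D.P.toRows₁.mulVec (x l - x' l))
      (u := fun l => D.Bo.mulVec (w l - w' l)) (l := matInfNorm D.Bo * d) l (fun q hq => ?_)
      fun q hq => (norm_mulVec_le _ _).trans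
        (mul_le_mul_of_nonneg_left (hdw q (by omega)) (matInfNorm_nonneg _))).trans ?_
    · simp only [he q (by omega), Matrix.mulVec_add, Matrix.mulVec_mulVec, D.P1_mul_A, D.P1_mul_B]
    · refine mul_le_mul_of_nonneg_right ?_ (mul_nonneg (matInfNorm_nonneg _) hd)
      exact Finset.sum_le_sum_of_subset_of_nonneg (Finset.range_mono hl)
        fun _ _ _ => matInfNorm_nonneg _
  -- Both trajectories explain the same measurement, so their outputs differ by at most the diameter
  -- of the measurement noise; removing the noise-driven part leaves the free response.
  have hobs : ∀ l ≤ F.δ, ‖(D.Co * D.Ao ^ l).mulVec (D.P.toRows₁.mulVec (x 0 - x' 0))‖ ≤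
      d + matInfNorm D.Co * ro := fun l hl => by
    have h1 : ‖C.mulVec (x l - x' l)‖ ≤ d := by
      have := hV _ _ (hmeas' l hl) _ (hmeas l hl)
      rwa [sub_sub_sub_cancel_left, ← Matrix.mulVec_sub] at this
    have h2 : (D.Co * D.Ao ^ l).mulVec (D.P.toRows₁.mulVec (x 0 - x' 0)) =
        C.mulVec (x l - x' l) - D.Co.mulVec (D.P.toRows₁.mulVec (x l - x' l) -
          (D.Ao ^ l).mulVec (D.P.toRows₁.mulVec (x 0 - x' 0))) := by
      rw [Matrix.mulVec_sub D.Co, Matrix.mulVec_mulVec _ D.Co, D.Co_mul_P1,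
        Matrix.mulVec_mulVec _ D.Co]
      abel
    rw [h2]
    exact (norm_sub_le _ _).trans (add_le_add h1 ((norm_mulVec_le _ _).trans
      (mul_le_mul_of_nonneg_left (heo l hl) (matInfNorm_nonneg _))))
  have he0 : ‖D.P.toRows₁.mulVec (x 0 - x' 0)‖ ≤ K₁ := by
    refine (hL _).trans (mul_le_mul_of_nonneg_left ?_ L.2)
    refine (pi_norm_le_iff_of_nonneg ((norm_nonneg _).trans (hobs 0 (Nat.zero_le _)))).2 fun r => ?_
    -- Block rows have index below `μ ≤ δ + 1`, so all of them lie in the window.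
    exact (norm_le_pi_norm _ r.2).trans (hobs r.1 (by have := r.1.2; omega))
  have h1 : ‖D.P.toRows₁.mulVec (x F.δ - x' F.δ)‖ ≤ K₂ := by
    have h2 := norm_le_norm_add_norm_sub' (D.P.toRows₁.mulVec (x F.δ - x' F.δ))
      ((D.Ao ^ F.δ).mulVec (D.P.toRows₁.mulVec (x 0 - x' 0)))
    exact h2.trans (add_le_add ((norm_mulVec_le _ _).trans
      (mul_le_mul_of_nonneg_left he0 (matInfNorm_nonneg _))) (heo _ le_rfl))
  refine ⟨h1.trans (by nlinarith [mul_nonneg hg hK₁]), x 0, hx0, x' 0, hx0', ?_⟩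
  have h3 := norm_le_norm_add_norm_sub' (x F.δ - x' F.δ) ((A ^ F.δ).mulVec (x 0 - x' 0))
  have h4 := norm_mulVec_le (A ^ F.δ) (x 0 - x' 0)
  have h5 := D.norm_le (x 0 - x' 0)
  set q := ‖D.P.toRows₂.mulVec (x 0 - x' 0)‖
  have hq : 0 ≤ q := norm_nonneg _
  have h6 : matInfNorm (A ^ F.δ) * ‖x 0 - x' 0‖ ≤ g * (K₁ + q) := by
    refine (mul_le_mul_of_nonneg_left h5 (matInfNorm_nonneg _)).trans ?_
    rw [← mul_assoc]
    exact mul_le_mul_of_nonneg_left (by linarith) hg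
  have h7 : 0 ≤ (K₂ + g * K₁ + ra) * q :=
    mul_nonneg (add_nonneg (add_nonneg hK₂ (mul_nonneg hg hK₁)) hra) hq
  linarith

end Filter

end SMF

namespace SMF

/-! ### Boundedness of the sets computed by the filter. -/

section Estimates

variable {n p m no nb : ℕ} {A : Matrix (Fin n) (Fin n) ℝ} {B : Matrix (Fin n) (Fin p) ℝ}
  {C : Matrix (Fin m) (Fin n) ℝ} (D : ObsDecomp A B C no nb) (F : FilterData n p m)

theorem isBounded_predictStep {Z : CZ (Fin n)} (hZ : Bornology.IsBounded Z.toSet)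
    (hW : ∀ k, Bornology.IsBounded (F.W k).toSet) (k : ℕ) :
    Bornology.IsBounded (predictStep A B F k Z).toSet := by
  refine ((isBounded_mulVec_image A hZ).add (isBounded_mulVec_image B (hW k))).subset fun x hx => ?_
  obtain ⟨z, hz, w, hw, rfl⟩ := (mem_predictStep F k Z x).1 hx
  exact Set.add_mem_add ⟨_, hz, rfl⟩ ⟨_, hw, rfl⟩

theorem isBounded_updateStep {Z : CZ (Fin n)} (hZ : Bornology.IsBounded Z.toSet) (k : ℕ) :
    Bornology.IsBounded (updateStep C F k Z).toSet :=
  hZ.subset fun x hx => ((mem_updateStep F k Z x).1 hx).1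

theorem isBounded_filterMap {Z : CZ (Fin n)} (hZ : Bornology.IsBounded Z.toSet)
    (hW : ∀ k, Bornology.IsBounded (F.W k).toSet) (i j : ℕ) :
    Bornology.IsBounded (filterMap A B C F i Z j).toSet := by
  induction j with
  | zero => exact isBounded_updateStep F hZ _
  | succ j ih => exact isBounded_updateStep F (isBounded_predictStep F ih hW _) _

theorem norm_sub_le_of_mem_box {d : ℕ} {c : Fin d → ℝ} {r : ℝ} (hr : 0 ≤ r) {x : Fin d → ℝ}
    (hx : x ∈ (CZ.box c fun _ => ENNReal.ofReal r).toSet) : ‖x - c‖ ≤ r :=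
  (pi_norm_le_iff_of_nonneg hr).2 fun i =>
    (ENNReal.ofReal_le_ofReal_iff hr).1 ((CZ.mem_box _ _ _).1 hx i)

theorem mem_box_of_norm_sub_le {d : ℕ} {c : Fin d → ℝ} {r : ℝ} {x : Fin d → ℝ}
    (hx : ‖x - c‖ ≤ r) : x ∈ (CZ.box c fun _ => ENNReal.ofReal r).toSet :=
  (CZ.mem_box _ _ _).2 fun i => ENNReal.ofReal_le_ofReal ((norm_le_pi_norm (x - c) i).trans hx)

theorem isBounded_box {d : ℕ} (c : Fin d → ℝ) (r : Fin d → ℝ) :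
    Bornology.IsBounded (CZ.box c fun i => ENNReal.ofReal (r i)).toSet := by
  refine (Metric.isBounded_closedBall (x := c) (r := ‖r‖)).subset fun x hx => ?_
  rw [mem_closedBall_iff_norm]
  refine norm_sub_le_of_mem_box (norm_nonneg _) ((CZ.mem_box _ _ _).2 fun i => ?_)
  refine ((CZ.mem_box _ _ _).1 hx i).trans (ENNReal.ofReal_le_ofReal ?_)
  exact (le_abs_self _).trans (norm_le_pi_norm r i)

theorem center_mem_box {d : ℕ} (c : Fin d → ℝ) (h : Fin d → ℝ≥0∞) : c ∈ (CZ.box c h).toSet :=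
  (CZ.mem_box _ _ _).2 fun i => by simp

theorem isBounded_assemble {Zo : CZ (Fin no)} {Zb : CZ (Fin nb)}
    (ho : Bornology.IsBounded Zo.toSet) (hb : Bornology.IsBounded Zb.toSet) :
    Bornology.IsBounded (assemble D Zo Zb).toSet := by
  obtain ⟨r, hr⟩ := Metric.isBounded_iff.1 ho
  obtain ⟨q, hq⟩ := Metric.isBounded_iff.1 hb
  refine isBounded_of_norm_sub_le (d := matInfNorm D.Pinv * (r + q)) fun s hs t ht => ?_
  obtain ⟨hs1, hs2⟩ := (mem_assemble D _ _ _).1 hs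
  obtain ⟨ht1, ht2⟩ := (mem_assemble D _ _ _).1 ht
  refine (D.norm_le _).trans (mul_le_mul_of_nonneg_left (add_le_add ?_ ?_) (matInfNorm_nonneg _))
  · rw [Matrix.mulVec_sub, ← dist_eq_norm]; exact hr hs1 ht1
  · rw [Matrix.mulVec_sub, ← dist_eq_norm]; exact hq hs2 ht2

theorem isBounded_resetInit (hX0 : Bornology.IsBounded F.X0hat.toSet) (a : ℝ) :
    Bornology.IsBounded (resetInit D F a).toSet := by
  refine isBounded_assemble D (isBounded_box _ _) ?_
  refine (isBounded_mulVec_image D.P.toRows₂ hX0).subset fun x hx => ?_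
  obtain ⟨z, hz, rfl⟩ := (CZ.mem_image _ _ _).1 hx
  exact ⟨z, hz, rfl⟩

/-- In the first phase the estimates are bounded. -/
theorem isBounded_estimate_of_lt (hX0 : Bornology.IsBounded F.X0hat.toSet)
    (hW : ∀ k, Bornology.IsBounded (F.W k).toSet) (k : ℕ) (hk : k < F.δ) :
    Bornology.IsBounded (estimate D F k).toSet := by
  induction k with
  | zero =>
    rw [estimate_eq, nextEstimate, if_pos hk, earlyEstimate]
    split_ifs
    · exact isBounded_filterMap F (isBounded_resetInit D F hX0 _) hW _ _
    · exact isBounded_updateStep F hX0 _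
  | succ k ih =>
    rw [estimate_eq, nextEstimate, if_pos hk, earlyEstimate]
    split_ifs
    · exact isBounded_filterMap F (isBounded_resetInit D F hX0 _) hW _ _
    · refine isBounded_updateStep F (isBounded_predictStep F ?_ hW _) _
      split_ifs
      · exact ih (by omega)
      · exact isBounded_filterMap F hX0 hW _ _

theorem estimate_of_le {k : ℕ} (hk : F.δ ≤ k) : estimate D F k = filterMap A B C F (k - F.δ)
    (assemble D (CZ.box 0 fun _ => ⊤) (unobsSet D F (estimate D F) (k - F.δ))) F.δ := by
  rw [estimate_eq, nextEstimate, if_neg (not_lt.2 hk)]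

theorem mem_assemble_top (Zb : CZ (Fin nb)) (x : Fin n → ℝ) :
    x ∈ (assemble D (CZ.box 0 fun _ => ⊤) Zb).toSet ↔ D.P.toRows₂.mulVec x ∈ Zb.toSet := by
  rw [mem_assemble, CZ.mem_box]
  simp

/-- A box contains its centre whatever its radii, since negative ones are truncated to `0`. Nothing
about the estimates is needed, so this is available before their non-emptiness is known. -/
theorem unobsSet_nonempty (Zs : ℕ → CZ (Fin n)) (k : ℕ) : (unobsSet D F Zs k).toSet.Nonempty := by
  unfold unobsSet intervalHull
  split_ifs
  · exact ⟨_, center_mem_box _ _⟩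
  · exact ⟨_, center_mem_box _ _⟩

theorem isBounded_unobsSet (Zs : ℕ → CZ (Fin n)) (k : ℕ) :
    Bornology.IsBounded (unobsSet D F Zs k).toSet := by
  unfold unobsSet intervalHull
  split_ifs
  · exact isBounded_box _ _
  · exact isBounded_box _ _

theorem ell_mono (Zs : ℕ → CZ (Fin n)) : Monotone (ell D F Zs) :=
  monotone_nat_of_le_succ fun _ => le_max_right _ _

theorem ell_nonneg (Zs : ℕ → CZ (Fin n)) (j : ℕ) : 0 ≤ ell D F Zs j :=
  ell_mono D F Zs (Nat.zero_le j)

/-- Inputs involve the estimate only through its observable coordinates, for which the window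
supplies a bound independent of the cubes. -/
theorem norm_sub_le_of_mem_inputSet {Zs : ℕ → CZ (Fin n)} {k : ℕ} {K d : ℝ}
    (hZ : ∀ s ∈ (Zs k).toSet, ∀ t ∈ (Zs k).toSet, ‖D.P.toRows₁.mulVec (s - t)‖ ≤ K)
    (hW : ∀ a ∈ (F.W k).toSet, ∀ b ∈ (F.W k).toSet, ‖a - b‖ ≤ d) :
    ∀ s ∈ inputSet D F Zs k, ∀ t ∈ inputSet D F Zs k,
      ‖s - t‖ ≤ matInfNorm D.A21 * K + matInfNorm D.Bb * d := by
  intro s hs t ht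
  obtain ⟨a, ha, w, hw, rfl⟩ := (CZ.mem_predict _ _ _ _ _).1 hs
  obtain ⟨b, hb, w', hw', rfl⟩ := (CZ.mem_predict _ _ _ _ _).1 ht
  obtain ⟨a', ha', rfl⟩ := (CZ.mem_image _ _ _).1 ha
  obtain ⟨b', hb', rfl⟩ := (CZ.mem_image _ _ _).1 hb
  rw [add_sub_add_comm, ← Matrix.mulVec_sub, ← Matrix.mulVec_sub, ← Matrix.mulVec_sub]
  exact (norm_add_le _ _).trans (add_le_add
    ((norm_mulVec_le _ _).trans (mul_le_mul_of_nonneg_left (hZ a' ha' b' hb') (matInfNorm_nonneg _)))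
    ((norm_mulVec_le _ _).trans (mul_le_mul_of_nonneg_left (hW w hw w' hw') (matInfNorm_nonneg _))))

theorem ell_le {Zs : ℕ → CZ (Fin n)} {g : ℝ} (hg : 0 ≤ g)
    (h : ∀ j, ‖hullRadius (inputSet D F Zs (F.δ + j))‖ ≤ g) (j : ℕ) : ell D F Zs j ≤ g := by
  induction j with
  | zero => exact hg
  | succ j ih => exact max_le (by rw [matInfNorm_diagonal]; exact h j) ih

end Estimates

/-! ### Comparison of the estimates with the true states. -/

section Inclusion

variable {Ω : Type*} {n p m no nb : ℕ} {S : UncertainSystem Ω n p m}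
  (D : ObsDecomp S.A S.B S.C no nb) {F : FilterData n p m}

theorem sub_mulVec_state_mem (hV : ∀ k, (F.V k).toSet = Set.range (S.v k)) {k : ℕ} {ω : Ω}
    (hω : S.meas k ω = F.y k) : F.y k - S.C.mulVec (S.state k ω) ∈ (F.V k).toSet := by
  rw [hV, ← hω]
  exact ⟨ω, by simp [UncertainSystem.meas]⟩

theorem state_mem_filterMap (hW : ∀ k, (F.W k).toSet = Set.range (S.w k))
    (hV : ∀ k, (F.V k).toSet = Set.range (S.v k)) {ω : Ω} {i : ℕ} {Z : CZ (Fin n)}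
    (hZ : S.state i ω ∈ Z.toSet) (j : ℕ) (hω : ∀ l ≤ i + j, S.meas l ω = F.y l) :
    S.state (i + j) ω ∈ (filterMap S.A S.B S.C F i Z j).toSet := by
  induction j with
  | zero => exact (mem_updateStep F i Z _).2 ⟨hZ, sub_mulVec_state_mem hV (hω i le_rfl)⟩
  | succ j ih =>
    refine (mem_updateStep F _ _ _).2 ⟨?_, sub_mulVec_state_mem hV (hω _ le_rfl)⟩
    refine (mem_predictStep F _ _ _).2
      ⟨_, ih fun l hl => hω l (by omega), S.w (i + j) ω, ?_, rfl⟩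
    rw [hW]
    exact ⟨ω, rfl⟩

/-- The measurements only involve the observable coordinates: if the observable coordinates of the
true state occur in `Z`, then they keep occurring in the filtered sets. -/
theorem exists_mem_filterMap (hW : ∀ k, (F.W k).toSet = Set.range (S.w k))
    (hV : ∀ k, (F.V k).toSet = Set.range (S.v k)) {ω : Ω} {i : ℕ} {Z : CZ (Fin n)}
    (hZ : ∃ z ∈ Z.toSet, D.P.toRows₁.mulVec z = D.P.toRows₁.mulVec (S.state i ω)) (j : ℕ)
    (hω : ∀ l ≤ i + j, S.meas l ω = F.y l) :
    ∃ s ∈ (filterMap S.A S.B S.C F i Z j).toSet,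
      D.P.toRows₁.mulVec s = D.P.toRows₁.mulVec (S.state (i + j) ω) := by
  -- Outputs factor through the observable coordinates, so `z` passes every measurement test that
  -- the true state passes.
  have hC : ∀ {x x' : Fin n → ℝ}, D.P.toRows₁.mulVec x = D.P.toRows₁.mulVec x' →
      S.C.mulVec x = S.C.mulVec x' := fun {x x'} h => by
    rw [← D.Co_mul_P1, ← Matrix.mulVec_mulVec, h, Matrix.mulVec_mulVec]
  induction j with
  | zero =>
    obtain ⟨z, hz, hz'⟩ := hZ
    refine ⟨z, (mem_updateStep F i Z _).2 ⟨hz, ?_⟩, hz'⟩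
    rw [hC hz']
    exact sub_mulVec_state_mem hV (hω i le_rfl)
  | succ j ih =>
    obtain ⟨z, hz, hz'⟩ := ih fun l hl => hω l (by omega)
    have hnext : D.P.toRows₁.mulVec (S.A.mulVec z + S.B.mulVec (S.w (i + j) ω)) =
        D.P.toRows₁.mulVec (S.state (i + (j + 1)) ω) := by
      change _ = D.P.toRows₁.mulVec (S.A.mulVec (S.state (i + j) ω) + S.B.mulVec (S.w (i + j) ω))
      rw [Matrix.mulVec_add, Matrix.mulVec_add, Matrix.mulVec_mulVec, Matrix.mulVec_mulVec _ _ S.A,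
        D.P1_mul_A, ← Matrix.mulVec_mulVec, ← Matrix.mulVec_mulVec, hz']
    refine ⟨_, (mem_updateStep F _ _ _).2 ⟨(mem_predictStep F _ _ _).2
      ⟨z, hz, S.w (i + j) ω, ?_, rfl⟩, ?_⟩, hnext⟩
    · rw [hW]
      exact ⟨ω, rfl⟩
    · rw [hC hnext]
      exact sub_mulVec_state_mem hV (hω _ le_rfl)

/-- In the second phase the estimates contain the observable coordinates of the true states. -/
theorem exists_mem_estimate (hW : ∀ k, (F.W k).toSet = Set.range (S.w k))
    (hV : ∀ k, (F.V k).toSet = Set.range (S.v k)) {ω : Ω} {k : ℕ} (hk : F.δ ≤ k)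
    (hω : ∀ l ≤ k, S.meas l ω = F.y l) :
    ∃ s ∈ (estimate D F k).toSet,
      D.P.toRows₁.mulVec s = D.P.toRows₁.mulVec (S.state k ω) := by
  obtain ⟨b, hb⟩ := unobsSet_nonempty D F (estimate D F) (k - F.δ)
  -- The start of the window leaves the observable coordinates free, so the true ones may be paired
  -- with any available `b`.
  obtain ⟨z, hz1, hz2⟩ := exists_coords D (D.P.toRows₁.mulVec (S.state (k - F.δ) ω)) b
  have hkδ : k - F.δ + F.δ = k := Nat.sub_add_cancel hk
  have := exists_mem_filterMap D hW hV (ω := ω) (i := k - F.δ)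
    ⟨z, (mem_assemble_top D (unobsSet D F (estimate D F) (k - F.δ)) z).2 (hz2 ▸ hb), hz1⟩ F.δ
    (by rwa [hkδ])
  rwa [← estimate_of_le D F hk, hkδ] at this

theorem estimate_nonempty (hX0ne : F.X0hat.toSet.Nonempty)
    (hW : ∀ k, (F.W k).toSet = Set.range (S.w k))
    (hV : ∀ k, (F.V k).toSet = Set.range (S.v k))
    (hy : S.IsObserved F.y) (hα : ResetsLargeEnough D F) (k : ℕ) :
    (estimate D F k).toSet.Nonempty := by
  obtain ⟨ω, hω⟩ := hy k
  rcases lt_or_ge k F.δ with hk | hk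
  · rw [estimate_eq, nextEstimate, if_pos hk, earlyEstimate]
    split_ifs with he
    -- A cube reaching the true initial observable coordinates makes the reset succeed, whatever the
    -- guess for the unobservable ones; adding `1` makes the edge positive.
    · refine (hα k hk).2 ⟨‖D.P.toRows₁.mulVec (S.state 0 ω)‖ + 1, by positivity, ?_⟩
      obtain ⟨b, hb⟩ := hX0ne
      obtain ⟨z, hz1, hz2⟩ := exists_coords D (D.P.toRows₁.mulVec (S.state 0 ω))
        (D.P.toRows₂.mulVec b)
      have hz : z ∈ (resetInit D F (‖D.P.toRows₁.mulVec (S.state 0 ω)‖ + 1)).toSet := by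
        refine (mem_assemble D _ _ _).2
          ⟨mem_box_of_norm_sub_le ?_, (CZ.mem_image _ _ _).2 ⟨b, hb, hz2⟩⟩
        rw [hz1, sub_zero]
        linarith
      obtain ⟨s, hs, -⟩ := exists_mem_filterMap D hW hV (ω := ω) (i := 0) ⟨z, hz, hz1⟩ k
        (by simpa using hω)
      exact ⟨s, hs⟩
    · exact Set.nonempty_iff_ne_empty.2 he
  · obtain ⟨s, hs, -⟩ := exists_mem_estimate D hW hV hk hω
    exact ⟨s, hs⟩

/-- Once the transient of the unobservable error has decayed below `ε`, the cubes contain the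
unobservable coordinates of the true states. -/
theorem exists_unobs_mem (hdet : IsDetectable S.A S.C) (hx0 : Bornology.IsBounded (Set.range S.x0))
    (hwb : ∀ k, Bornology.IsBounded (Set.range (S.w k)))
    (hW : ∀ k, (F.W k).toSet = Set.range (S.w k))
    (hV : ∀ k, (F.V k).toSet = Set.range (S.v k)) (hε : 0 < F.ε)
    (hin : ∀ j, Bornology.IsBounded (inputSet D F (estimate D F) (F.δ + j))) :
    ∃ j₀, ∀ j, j₀ ≤ j → ∀ ω, (∀ l ≤ F.δ + j, S.meas l ω = F.y l) →
      ‖D.P.toRows₂.mulVec (S.state (F.δ + j) ω) - centerB D F (estimate D F) j‖ ≤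
        radiusB D F (estimate D F) j := by
  have hρ := D.specRadius_Ab_lt_one hdet
  -- The initial error is bounded uniformly in `ω`, so that `j₀` does not depend on the sample
  -- point.
  obtain ⟨E, hE⟩ : ∃ E : ℝ, ∀ ω,
      ‖D.P.toRows₂.mulVec (S.state F.δ ω) - centerB D F (estimate D F) 0‖ ≤ E := by
    obtain ⟨r, hr⟩ := (Metric.isBounded_iff_subset_closedBall (centerB D F (estimate D F) 0)).1
      (isBounded_mulVec_image D.P.toRows₂ (isBounded_range_state S hx0 hwb F.δ))
    exact ⟨r, fun ω => mem_closedBall_iff_norm.1 (hr ⟨_, ⟨ω, rfl⟩, rfl⟩)⟩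
  have ht := (tendsto_matInfNorm_pow D.Ab hρ).mul_const E
  rw [zero_mul] at ht
  obtain ⟨j₀, hj₀⟩ := Filter.eventually_atTop.1 (ht.eventually (gt_mem_nhds hε))
  refine ⟨j₀, fun j hj ω hω => ?_⟩
  set Zs := estimate D F with hZs
  have hrec := norm_le_of_recursion D.Ab
    (e := fun i => D.P.toRows₂.mulVec (S.state (F.δ + i) ω) - centerB D F Zs i)
    (u := fun i => D.A21.mulVec (D.P.toRows₁.mulVec (S.state (F.δ + i) ω)) +
      D.Bb.mulVec (S.w (F.δ + i) ω) - hullCenter (inputSet D F Zs (F.δ + i)))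
    (l := ell D F Zs j) j (fun i _ => ?_) fun i hi => ?_
  -- The forced error is covered by the `upsilonInf` term and the transient by `ε`; the diameter
  -- term of the radius only has to be non-negative.
  · have h1 := mul_le_mul_of_nonneg_right (sum_matInfNorm_pow_le_upsilonInf D.Ab hρ j)
      (ell_nonneg D F Zs j)
    have h2 := (norm_mulVec_le (D.Ab ^ j)
      (D.P.toRows₂.mulVec (S.state F.δ ω) - centerB D F Zs 0)).trans
      (mul_le_mul_of_nonneg_left (hE ω) (matInfNorm_nonneg _))
    have h3 := norm_le_norm_add_norm_sub'
      (D.P.toRows₂.mulVec (S.state (F.δ + j) ω) - centerB D F Zs j)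
      ((D.Ab ^ j).mulVec (D.P.toRows₂.mulVec (S.state F.δ ω) - centerB D F Zs 0))
    have h4 := mul_nonneg (matInfNorm_nonneg (D.Ab ^ j))
      (diamInf_nonneg (projB D (Zs F.δ)).toSet)
    have h5 := hj₀ j hj
    rw [radiusB]
    simp only [add_zero] at hrec
    linarith
  · change D.P.toRows₂.mulVec (S.A.mulVec (S.state (F.δ + i) ω) + S.B.mulVec (S.w (F.δ + i) ω)) -
      (D.Ab.mulVec (centerB D F Zs i) + hullCenter (inputSet D F Zs (F.δ + i))) = _
    rw [Matrix.mulVec_add, Matrix.mulVec_mulVec, Matrix.mulVec_mulVec, D.P2_mul_A, D.P2_mul_B,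
      Matrix.add_mulVec, Matrix.mulVec_sub, Matrix.mulVec_mulVec, Matrix.mulVec_mulVec]
    abel
  · obtain ⟨s, hs, hs'⟩ := exists_mem_estimate D hW hV (ω := ω) (k := F.δ + i) (by omega)
      fun l hl => hω l (by omega)
    have hmem : D.A21.mulVec (D.P.toRows₁.mulVec (S.state (F.δ + i) ω)) +
        D.Bb.mulVec (S.w (F.δ + i) ω) ∈ inputSet D F Zs (F.δ + i) := by
      refine (CZ.mem_predict _ _ _ _ _).2
        ⟨_, (CZ.mem_image _ _ _).2 ⟨s, hs, hs'.symm⟩, S.w (F.δ + i) ω, ?_, rfl⟩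
      rw [hW]
      exact ⟨ω, rfl⟩
    refine (norm_sub_hullCenter_le (hin i) hmem).trans ?_
    rw [← matInfNorm_diagonal]
    -- The radius at step `i` enters `ell` at index `i + 1`, and `ell` at index `j` dominates all
    -- steps `i < j`.
    exact (le_max_left _ _).trans (ell_mono D F Zs (show i + 1 ≤ j by omega))

/-- The diameters of the sets for the unobservable coordinates are uniformly bounded. -/
theorem exists_unobsSet_bound (D : ObsDecomp S.A S.B S.C no nb) (hdet : IsDetectable S.A S.C)
    {g : ℝ} (hg : ∀ j, ell D F (estimate D F) j ≤ g) :
    ∃ K : ℝ, ∀ k, ∀ s ∈ (unobsSet D F (estimate D F) k).toSet,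
      ∀ t ∈ (unobsSet D F (estimate D F) k).toSet, ‖s - t‖ ≤ K := by
  have hρ := D.specRadius_Ab_lt_one hdet
  have hΥ : 0 ≤ upsilonInf D.Ab := by simpa using sum_matInfNorm_pow_le_upsilonInf D.Ab hρ 0
  obtain ⟨M, hM⟩ := (tendsto_matInfNorm_pow D.Ab hρ).bddAbove_range
  have hM' : ∀ j, matInfNorm (D.Ab ^ j) ≤ M := fun j => hM ⟨j, rfl⟩
  set Zs := estimate D F
  set R := M * diamInf (projB D (Zs F.δ)).toSet + upsilonInf D.Ab * g + F.ε
  have hR : ∀ j, radiusB D F Zs j ≤ R := fun j =>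
    add_le_add_left (add_le_add (mul_le_mul_of_nonneg_right (hM' j) (diamInf_nonneg _))
      (mul_le_mul_of_nonneg_left (hg j) hΥ)) _
  obtain ⟨K, hK, hK'⟩ :=
    exists_forall_lt_le (fun k => Metric.diam (unobsSet D F Zs k).toSet) (max F.δ 1)
  refine ⟨K + (|R| + |R|), fun k s hs t ht => ?_⟩
  rcases lt_or_ge k (max F.δ 1) with hk | hk
  · have h1 := Metric.dist_le_diam_of_mem (isBounded_unobsSet D F Zs k) hs ht
    rw [dist_eq_norm] at h1
    linarith [hK' k hk, abs_nonneg R]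
  -- The absolute value avoids having to determine the sign of `R`.
  · have hball : ∀ x ∈ (unobsSet D F Zs k).toSet, ‖x - centerB D F Zs (k - F.δ)‖ ≤ |R| := by
      intro x hx
      rw [unobsSet, if_neg (not_lt.2 hk)] at hx
      refine norm_sub_le_of_mem_box (abs_nonneg _) ((CZ.mem_box _ _ _).2 fun i => ?_)
      exact ((CZ.mem_box _ _ _).1 hx i).trans
        (ENNReal.ofReal_le_ofReal ((hR _).trans (le_abs_self R)))
    rw [← sub_sub_sub_cancel_right s t (centerB D F Zs (k - F.δ))]
    exact (norm_sub_le _ _).trans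
      ((add_le_add (hball s hs) (hball t ht)).trans (by linarith))

end Inclusion

end SMF

/-! ### Assembly of the three properties. -/

theorem theorem4 {Ω : Type*} {n p m no nb : ℕ} (S : SMF.UncertainSystem Ω n p m)
    (hA : IsUnit S.A.det)
    (hx0 : Bornology.IsBounded (Set.range S.x0))
    (hw : SMF.UniformlyBounded fun k => Set.range (S.w k))
    (hv : SMF.UniformlyBounded fun k => Set.range (S.v k))
    (hunrel : S.Unrelated)
    (hdet : SMF.IsDetectable S.A S.C)
    (D : SMF.ObsDecomp S.A S.B S.C no nb)
    (F : SMF.FilterData n p m)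
    (hX0 : Bornology.IsBounded F.X0hat.toSet) (hX0ne : F.X0hat.toSet.Nonempty)
    (hW : ∀ k, (F.W k).toSet = Set.range (S.w k))
    (hV : ∀ k, (F.V k).toSet = Set.range (S.v k))
    (hy : S.IsObserved F.y)
    (hδ : SMF.obsIndex D.Ao D.Co ≤ F.δ + 1)
    (hε : 0 < F.ε)
    (hα : SMF.ResetsLargeEnough D F) :
    SMF.IsStable (fun k => (SMF.estimate D F k).toSet) (S.condRange F.y) ∧
    (∃ k₀ : ℕ, 2 * F.δ ≤ k₀ ∧
      ∀ k, k₀ ≤ k → S.condRange F.y k ⊆ (SMF.estimate D F k).toSet) ∧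
    SMF.UniformlyBounded (fun k => (SMF.estimate D F k).toSet) := by
  open SMF in
  obtain ⟨dw, hdw, hdw'⟩ := hw.exists_norm_sub_le
  obtain ⟨dv, hdv, hdv'⟩ := hv.exists_norm_sub_le
  have hwb : ∀ k, Bornology.IsBounded (Set.range (S.w k)) := fun k =>
    isBounded_of_norm_sub_le (hdw' k)
  have hWb : ∀ k, Bornology.IsBounded (F.W k).toSet := fun k => by rw [hW]; exact hwb k
  have hWd : ∀ k, ∀ a ∈ (F.W k).toSet, ∀ b ∈ (F.W k).toSet, ‖a - b‖ ≤ dw + dv := by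
    intro k a ha b hb
    rw [hW] at ha hb
    linarith [hdw' k a ha b hb]
  have hVd : ∀ k, ∀ a ∈ (F.V k).toSet, ∀ b ∈ (F.V k).toSet, ‖a - b‖ ≤ dw + dv := by
    intro k a ha b hb
    rw [hV] at ha hb
    linarith [hdv' k a ha b hb]
  obtain ⟨K, hK, hfil⟩ := exists_filterMap_bound D F (add_nonneg hdw hdv) hWd hVd hδ
  have hproj : ∀ k, F.δ ≤ k → ∀ s ∈ (estimate D F k).toSet, ∀ t ∈ (estimate D F k).toSet,
      ‖D.P.toRows₁.mulVec (s - t)‖ ≤ K := by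
    intro k hk s hs t ht
    rw [estimate_of_le D F hk] at hs ht
    exact (hfil _ _ s hs t ht).1
  have hin : ∀ j, ∀ s ∈ inputSet D F (estimate D F) (F.δ + j),
      ∀ t ∈ inputSet D F (estimate D F) (F.δ + j),
      ‖s - t‖ ≤ matInfNorm D.A21 * K + matInfNorm D.Bb * (dw + dv) := fun j =>
    norm_sub_le_of_mem_inputSet D F (hproj _ (Nat.le_add_right _ _)) (hWd _)
  have hg0 : 0 ≤ matInfNorm D.A21 * K + matInfNorm D.Bb * (dw + dv) :=
    add_nonneg (mul_nonneg (matInfNorm_nonneg _) hK)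
      (mul_nonneg (matInfNorm_nonneg _) (add_nonneg hdw hdv))
  obtain ⟨Q, hQ⟩ := exists_unobsSet_bound D hdet
    (ell_le D F hg0 fun j => norm_hullRadius_le hg0 (hin j))
  have hbdd : UniformlyBounded fun k => (estimate D F k).toSet := by
    refine uniformlyBounded_of_le (d := K * (1 + Q)) F.δ
      (isBounded_estimate_of_lt D F hX0 hWb) fun k hk s hs t ht => ?_
    rw [estimate_of_le D F hk] at hs ht
    obtain ⟨-, a, ha, b, hb, hab⟩ := hfil _ _ s hs t ht
    rw [mem_assemble_top] at ha hb
    have := hQ _ _ ha _ hb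
    rw [← Matrix.mulVec_sub] at this
    exact hab.trans (mul_le_mul_of_nonneg_left (by linarith) hK)
  obtain ⟨j₀, hj₀⟩ := exists_unobs_mem D hdet hx0 hwb hW hV hε
    fun j => isBounded_of_norm_sub_le (hin j)
  -- The window of time `k` starts at `k - δ`, which must be at least `δ + j₀` for its cube to be
  -- valid. The extra `1` matters for `δ = 0`, where the set at time `0` is still an interval hull.
  have hincl : ∀ k, 2 * F.δ + j₀ + 1 ≤ k → S.condRange F.y k ⊆ (estimate D F k).toSet := by
    rintro k hk _ ⟨ω, hω, rfl⟩
    obtain ⟨j, rfl⟩ : ∃ j, k = F.δ + j + F.δ := ⟨k - 2 * F.δ, by omega⟩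
    rw [estimate_of_le D F (Nat.le_add_left _ _), Nat.add_sub_cancel]
    refine state_mem_filterMap hW hV ?_ F.δ hω
    rw [mem_assemble_top, unobsSet, if_neg (by simp; omega), Nat.add_sub_cancel_left]
    exact mem_box_of_norm_sub_le (hj₀ j (by omega) ω fun l hl => hω l (by omega))
  refine ⟨isStable_of_eventually_subset _ (estimate_nonempty D hX0ne hW hV hy hα) hbdd
    (fun k => ?_) (fun k => ?_) hincl, ⟨_, by omega, hincl⟩, hbdd⟩
  · obtain ⟨ω, hω⟩ := hy k
    exact ⟨_, ω, hω, rfl⟩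
  · refine (isBounded_range_state S hx0 hwb k).subset ?_
    rintro _ ⟨ω, -, rfl⟩
    exact ⟨ω, rfl⟩
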